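/- Let $X=(X_t)_{t\ge 0}$ be a real-valued Lévy process (started at $0$, independent and stationary increments, a.s. càdlàg paths) with $\mathbb E[X_t]=0$ and $\mathbb E[X_t^2]<\infty$ for all $t\ge 0$. Let $\nu$ be the Lévy measure of $X$, that is, the measure on $\mathbb R\setminus\{0\}$ with $\int\min(1,x^2)\,\nu(dx)<\infty$ in its Lévy–Khintchine representation: for all $t\ge 0$ and $z\in\mathbb R$, $$\mathbb E[e^{izX_t}]=e^{-t\Psi(z)},\qquad \Psi(z)=\tfrac12\sigma^2z^2-iaz-\int_{\mathbb R\setminus\{0\}}\bigl(e^{izx}-1-izx\,h(x)\bigr)\,\nu(dx),$$ where $a\in\mathbb R$, $\sigma^2\ge 0$, and $h$ is any cut-off function for which the integrals converge (for the processes considered here, $h\equiv 1$, with $a=0$, is possible). Let $T>0$, and let $(e_k)_{k\ge 1}$ be an orthonormal basis of $L^2([0,T])$ consisting of eigenfunctions of the covariance operator $$(Kf)(s)=\int_0^T\operatorname{Cov}(X_s,X_t)f(t)\,dt,$$ ordered so that the eigenvalues are non-increasing, and let $Z_k=\int_0^TX_te_k(t)\,dt$, $k\ge 1$, be the Karhunen–Loève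 coefficients of $X$ on $[0,T]$. Then, for every integer $d\ge 2$, the random variables $Z_1,\dots,Z_d$ are independent if and only if $\nu$ is the zero measure. Equivalently, $Z_1,\dots,Z_d$ are independent if and only if $X$ is a scaled Wiener process, that is, for some $c\ge 0$, $X$ starts at $0$, has independent increments with $X_t-X_s\sim N(0,c(t-s))$ for $0\le s\le t$, and has a.s. continuous paths. -/

import Mathlib

open MeasureTheory ProbabilityTheory Filter Topology
open scoped NNReal ENNReal

noncomputable section

namespace LevyKL

/-- A path is càdlàg: right-continuous, with (finite) left limits. At time `0` the left limit is
taken along the trivial filter, so it imposes nothing there. -/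
def IsCadlag (x : ℝ≥0 → ℝ) : Prop :=
  ∀ t, ContinuousWithinAt x (Set.Ici t) t ∧ ∃ l : ℝ, Tendsto x (𝓝[<] t) (𝓝 l)

/-- A real-valued Lévy process: it starts at `0`, has independent and stationary increments, and
has càdlàg paths almost surely. -/
structure IsLevyProcess {Ω : Type*} [MeasurableSpace Ω] (X : ℝ≥0 → Ω → ℝ) (P : Measure Ω) :
    Prop where
  measurable : ∀ t, Measurable (X t)
  zero : ∀ᵐ ω ∂P, X 0 ω = 0
  indep : HasIndepIncrements X P
  stationary : ∀ s t, IdentDistrib (fun ω ↦ X (s + t) ω - X s ω) (fun ω ↦ X t ω - X 0 ω) P P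
  cadlag : ∀ᵐ ω ∂P, IsCadlag (fun t ↦ X t ω)

/-- The class `𝒦`: Lévy processes with zero mean and finite second moment. -/
structure IsCenteredSquareIntegrableLevy {Ω : Type*} [MeasurableSpace Ω]
    (X : ℝ≥0 → Ω → ℝ) (P : Measure Ω) : Prop extends IsLevyProcess X P where
  memLp : ∀ t, MemLp (X t) 2 P
  mean : ∀ t, ∫ ω, X t ω ∂P = 0

/-- A Lévy measure. A measure on `ℝ ∖ {0}` is represented by a measure on `ℝ` without an atom
at `0`. -/
structure IsLevyMeasure (ν : Measure ℝ) : Prop where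
  zero : ν {0} = 0
  lintegral_lt_top : ∫⁻ x, ENNReal.ofReal (min 1 (x ^ 2)) ∂ν < ∞

/-- The integrand `e^{izx} - 1 - i z x h(x)` of the Lévy–Khintchine formula, with cut-off `h`. -/
def levyIntegrand (h : ℝ → ℝ) (z x : ℝ) : ℂ :=
  Complex.exp (Complex.I * z * x) - 1 - Complex.I * z * x * h x

/-- The characteristic exponent
`Ψ(z) = σ² z² / 2 - i a z - ∫ (e^{izx} - 1 - i z x h(x)) ν(dx)`; the parameter `v` is `σ²`. -/
def levyExponent (h : ℝ → ℝ) (a : ℝ) (v : ℝ≥0) (ν : Measure ℝ) (z : ℝ) : ℂ :=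
  (v : ℂ) * z ^ 2 / 2 - Complex.I * a * z - ∫ x, levyIntegrand h z x ∂ν

/-- `X` has generating triple `(a, σ², ν)` (with `v = σ²`) relative to the cut-off function `h`:
`ν` is a Lévy measure, the integrals in the exponent `Ψ` converge, and
`E[exp (i z X_t)] = exp (-t Ψ(z))`. The measure `ν` is then the Lévy measure of `X`. -/
structure HasGeneratingTriple {Ω : Type*} [MeasurableSpace Ω] (X : ℝ≥0 → Ω → ℝ) (P : Measure Ω)
    (h : ℝ → ℝ) (a : ℝ) (v : ℝ≥0) (ν : Measure ℝ) : Prop where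
  isLevyMeasure : IsLevyMeasure ν
  integrable : ∀ z, Integrable (levyIntegrand h z) ν
  charFun_eq : ∀ (t : ℝ≥0) (z : ℝ),
    ∫ ω, Complex.exp (Complex.I * z * X t ω) ∂P = Complex.exp (-(t : ℂ) * levyExponent h a v ν z)

/-- The real Hilbert space `L²([0,T])`. -/
abbrev L2 (T : ℝ) : Type := Lp ℝ 2 (volume.restrict (Set.Icc (0 : ℝ) T))

/-- The covariance operator `(K f)(s) = ∫_0^T Cov(X_s, X_t) f(t) dt`. -/
def covOperator {Ω : Type*} [MeasurableSpace Ω] (X : ℝ≥0 → Ω → ℝ) (P : Measure Ω) (T : ℝ)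
    (f : ℝ → ℝ) (s : ℝ) : ℝ :=
  ∫ t in Set.Icc 0 T, cov[X s.toNNReal, X t.toNNReal; P] * f t

/-- `e` is a Karhunen–Loève basis of `X` on `[0,T]`: an orthonormal basis of `L²([0,T])`
consisting of eigenfunctions of the covariance operator, with eigenvalues `lam` in
non-increasing order. (Indices start at `0`.) -/
structure IsKLBasis {Ω : Type*} [MeasurableSpace Ω] (X : ℝ≥0 → Ω → ℝ) (P : Measure Ω) (T : ℝ)
    (e : HilbertBasis ℕ ℝ (L2 T)) (lam : ℕ → ℝ) : Prop where
  antitone : Antitone lam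
  eigen : ∀ k, covOperator X P T (e k) =ᵐ[volume.restrict (Set.Icc 0 T)] fun s ↦ lam k * e k s

/-- The stochastic coefficient `∫_0^T X_t f(t) dt`, a pathwise integral. -/
def stochCoeff {Ω : Type*} (X : ℝ≥0 → Ω → ℝ) (T : ℝ) (f : ℝ → ℝ) (ω : Ω) : ℝ :=
  ∫ t in Set.Icc 0 T, X t.toNNReal ω * f t

/-- `X` is a scaled Wiener process: for some `v = σ² ≥ 0` it starts at `0`, has independent
increments with `X_t - X_s ∼ N(0, σ² (t - s))`, and has continuous paths almost surely.
With `σ = 1` this is a standard Wiener process. -/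
def IsScaledWiener {Ω : Type*} [MeasurableSpace Ω] (X : ℝ≥0 → Ω → ℝ) (P : Measure Ω) : Prop :=
  ∃ v : ℝ≥0, (∀ᵐ ω ∂P, X 0 ω = 0) ∧ HasIndepIncrements X P ∧
    (∀ s t, s ≤ t → HasLaw (fun ω ↦ X t ω - X s ω) (gaussianReal 0 (v * (t - s))) P) ∧
    ∀ᵐ ω ∂P, Continuous fun t ↦ X t ω

end LevyKL

end

/-! Summation by parts turns a coefficient into a Wiener-type integral: `∫ X f = ∫ u dX` with `u(t)
= ∫_t^T f`. Independent stationary increments then give the characteristic function `exp (-∫_0^T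
Ψ(u(t)) dt)` (`integral_exp_stochCoeff`), so by linearity independence of coefficients is a
factorization identity for `Ψ`.

Write `R = Re Ψ`, which is even. Moduli of the factorization at `(p, q)` and `(p, -q)` show that
`2R(p u₀) + 2R(q u₁) - R(p u₀ + q u₁) - R(p u₀ - q u₁)` integrates to zero over `[0,T]`. This defect
equals `2 ∫ (1 - cos)(1 - cos) dν ≥ 0`, so by continuity it vanishes at every time, in particular at
`t = 0`. If `u₀(0), u₁(0) ≠ 0`, scaling `p, q` gives `R(2z) = 4R(z)`, hence `∫ (1 - cos zx)² dν = 0`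
for all `z`, and `ν = 0`.

The eigenrelation makes the `u_k` nonzero at `0` (`IsKLBasis.tailIntegral_zero_ne`) when `Var X₁ ≠
0`; when `Var X₁ = 0`, `R` vanishes outright. It also makes the `u_k` orthogonal, so for `ν = 0`,
where `Ψ` is quadratic plus linear, the exponents add up. Finally, `ν = 0` makes the increments
Gaussian, and Gaussian tails exclude jumps. -/

namespace LevyKL

/-! ### The Lévy–Khintchine exponent -/

section Exponent

lemma norm_exp_I_mul_sub_one_sub_le (θ : ℝ) :
    ‖Complex.exp (Complex.I * θ) - 1 - Complex.I * θ‖ ≤ 3 * θ ^ 2 := by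
  have hn : ‖Complex.I * (θ : ℂ)‖ = |θ| := by simp
  rcases le_or_gt |θ| 1 with hθ | hθ
  · refine (Complex.norm_exp_sub_one_sub_id_le (hn.trans_le hθ)).trans ?_
    rw [hn, sq_abs]
    nlinarith [sq_nonneg θ]
  · refine (norm_sub_le _ _).trans ?_
    have h1 : ‖Complex.exp (Complex.I * θ) - 1‖ ≤ |θ| :=
      Real.norm_eq_abs θ ▸ Real.norm_exp_I_mul_ofReal_sub_one_le
    rw [hn]
    nlinarith [sq_abs θ]

/-- The cut-off term is linear in `z`, so it cancels. Continuity of `Ψ` thus needs nothing of `h`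
beyond convergence. -/
lemma levyIntegrand_sub_mul (h : ℝ → ℝ) (z x : ℝ) :
    levyIntegrand h z x - z * levyIntegrand h 1 x =
      Complex.exp (Complex.I * (z * x : ℝ)) - 1 - z * (Complex.exp (Complex.I * x) - 1) := by
  simp only [levyIntegrand]
  push_cast
  ring_nf

lemma norm_levyIntegrand_sub_mul_le (h : ℝ → ℝ) (z x : ℝ) :
    ‖levyIntegrand h z x - z * levyIntegrand h 1 x‖ ≤
      (3 * z ^ 2 + 3 * |z| + 2) * min 1 (x ^ 2) := by
  rw [levyIntegrand_sub_mul]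
  have hz : ‖(z : ℂ)‖ = |z| := by simp
  rcases le_total 1 (x ^ 2) with hx | hx
  · rw [min_eq_left hx, mul_one]
    have h1 (θ : ℝ) : ‖Complex.exp (Complex.I * θ) - 1‖ ≤ 2 :=
      (norm_sub_le _ _).trans (by simp [Complex.norm_exp_I_mul_ofReal]; norm_num)
    refine (norm_sub_le _ _).trans ?_
    rw [norm_mul, hz]
    nlinarith [h1 (z * x), h1 x, abs_nonneg z, sq_nonneg z]
  · rw [min_eq_right hx]
    have e : Complex.exp (Complex.I * (z * x : ℝ)) - 1 - z * (Complex.exp (Complex.I * x) - 1) =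
        (Complex.exp (Complex.I * (z * x : ℝ)) - 1 - Complex.I * (z * x : ℝ)) -
          z * (Complex.exp (Complex.I * x) - 1 - Complex.I * x) := by
      push_cast
      ring
    rw [e]
    refine (norm_sub_le _ _).trans ?_
    rw [norm_mul, hz]
    have h1 := norm_exp_I_mul_sub_one_sub_le (z * x)
    have h2 := mul_le_mul_of_nonneg_left (norm_exp_I_mul_sub_one_sub_le x) (abs_nonneg z)
    nlinarith [sq_nonneg x]

variable {h : ℝ → ℝ} {a : ℝ} {v : ℝ≥0} {ν : Measure ℝ}

lemma IsLevyMeasure.integrable_min (hν : IsLevyMeasure ν) :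
    Integrable (fun x : ℝ ↦ min 1 (x ^ 2)) ν := by
  refine ⟨by fun_prop, ?_⟩
  rw [hasFiniteIntegral_iff_ofReal (.of_forall fun x ↦ by positivity)]
  exact hν.lintegral_lt_top

lemma continuous_levyExponent (hν : IsLevyMeasure ν) (hi : ∀ z, Integrable (levyIntegrand h z) ν) :
    Continuous (levyExponent h a v ν) := by
  have key : Continuous fun z : ℝ ↦
      ∫ x, (levyIntegrand h z x - z * levyIntegrand h 1 x) ∂ν := by
    refine continuous_iff_continuousAt.2 fun z₀ ↦ ?_
    refine continuousAt_of_dominated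
      (bound := fun x ↦ (3 * (|z₀| + 1) ^ 2 + 3 * (|z₀| + 1) + 2) * min 1 (x ^ 2)) ?_ ?_ ?_ ?_
    · exact .of_forall fun z ↦ ((hi z).sub ((hi 1).const_mul _)).aestronglyMeasurable
    · filter_upwards [Metric.ball_mem_nhds z₀ one_pos] with z hz
      refine .of_forall fun x ↦ (norm_levyIntegrand_sub_mul_le h z x).trans ?_
      have hz' : |z| ≤ |z₀| + 1 := by
        have := abs_sub_abs_le_abs_sub z z₀
        rw [Metric.mem_ball, Real.dist_eq] at hz
        linarith
      have h2 : z ^ 2 ≤ (|z₀| + 1) ^ 2 := by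
        rw [← sq_abs z]
        gcongr
      gcongr
    · exact hν.integrable_min.const_mul _
    · refine .of_forall fun x ↦ ?_
      simp only [levyIntegrand_sub_mul]
      fun_prop
  have e : levyExponent h a v ν = fun z : ℝ ↦ (v : ℂ) * z ^ 2 / 2 - Complex.I * a * z -
      ((∫ x, (levyIntegrand h z x - z * levyIntegrand h 1 x) ∂ν) +
        z * ∫ x, levyIntegrand h 1 x ∂ν) := by
    funext z
    rw [integral_sub (hi z) ((hi 1).const_mul _), integral_const_mul]
    simp [levyExponent]
  rw [e]
  fun_prop

lemma re_levyIntegrand (z x : ℝ) : (levyIntegrand h z x).re = -(1 - Real.cos (z * x)) := by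
  have e : Complex.I * z * x = (z * x : ℝ) * Complex.I := by push_cast; ring
  have e' : Complex.I * z * x * h x = (z * x * h x : ℝ) * Complex.I := by push_cast; ring
  rw [levyIntegrand, e', e, Complex.sub_re, Complex.sub_re, Complex.exp_ofReal_mul_I_re,
    Complex.re_ofReal_mul]
  simp

lemma integrable_one_sub_cos (hi : ∀ z, Integrable (levyIntegrand h z) ν) (z : ℝ) :
    Integrable (fun x : ℝ ↦ 1 - Real.cos (z * x)) ν := by
  have := (hi z).re.neg
  refine this.congr (.of_forall fun x ↦ ?_)
  have := re_levyIntegrand (h := h) z x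
  simp [this]

lemma re_levyExponent (hi : ∀ z, Integrable (levyIntegrand h z) ν) (z : ℝ) :
    (levyExponent h a v ν z).re = v * z ^ 2 / 2 + ∫ x, (1 - Real.cos (z * x)) ∂ν := by
  have h1 : (∫ x, levyIntegrand h z x ∂ν).re = -∫ x, (1 - Real.cos (z * x)) ∂ν := by
    rw [← integral_neg]
    have := integral_re (𝕜 := ℂ) (hi z)
    simp only [RCLike.re_to_complex, re_levyIntegrand] at this
    exact this.symm
  have e : (v : ℂ) * z ^ 2 / 2 - Complex.I * a * z =
      ((v * z ^ 2 / 2 : ℝ) : ℂ) - (a * z : ℝ) * Complex.I := by push_cast; ring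
  rw [levyExponent, Complex.sub_re, h1, e, Complex.sub_re, Complex.re_ofReal_mul,
    Complex.ofReal_re]
  simp

lemma re_levyExponent_neg (hi : ∀ z, Integrable (levyIntegrand h z) ν) (z : ℝ) :
    (levyExponent h a v ν (-z)).re = (levyExponent h a v ν z).re := by
  simp [re_levyExponent hi]

/-- The Gaussian part obeys the parallelogram law, so only jumps contribute to the defect, and with
a definite sign. -/
lemma re_levyExponent_parallelogram (hi : ∀ z, Integrable (levyIntegrand h z) ν) (p q : ℝ) :
    2 * (levyExponent h a v ν p).re + 2 * (levyExponent h a v ν q).re -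
      (levyExponent h a v ν (p + q)).re - (levyExponent h a v ν (p - q)).re =
      2 * ∫ x, (1 - Real.cos (p * x)) * (1 - Real.cos (q * x)) ∂ν := by
  have i := integrable_one_sub_cos hi
  simp only [re_levyExponent hi]
  rw [← integral_const_mul 2 fun x ↦ (1 - Real.cos (p * x)) * (1 - Real.cos (q * x))]
  have e : ∀ x, 2 * ((1 - Real.cos (p * x)) * (1 - Real.cos (q * x))) =
      2 * (1 - Real.cos (p * x)) + 2 * (1 - Real.cos (q * x)) - (1 - Real.cos ((p + q) * x)) -
        (1 - Real.cos ((p - q) * x)) := fun x ↦ by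
    rw [add_mul, sub_mul p, Real.cos_add, Real.cos_sub]
    ring
  simp only [e]
  have i₁ : Integrable (fun x : ℝ ↦
      2 * (1 - Real.cos (p * x)) + 2 * (1 - Real.cos (q * x))) ν :=
    ((i p).const_mul 2).add ((i q).const_mul 2)
  have i₂ : Integrable (fun x : ℝ ↦ 2 * (1 - Real.cos (p * x)) + 2 * (1 - Real.cos (q * x)) -
      (1 - Real.cos ((p + q) * x))) ν := i₁.sub (i _)
  rw [integral_sub i₂ (i _), integral_sub i₁ (i _),
    integral_add ((i p).const_mul 2) ((i q).const_mul 2), integral_const_mul, integral_const_mul]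
  ring

lemma re_levyExponent_parallelogram_nonneg (hi : ∀ z, Integrable (levyIntegrand h z) ν)
    (p q : ℝ) : 0 ≤ 2 * (levyExponent h a v ν p).re + 2 * (levyExponent h a v ν q).re -
      (levyExponent h a v ν (p + q)).re - (levyExponent h a v ν (p - q)).re := by
  rw [re_levyExponent_parallelogram hi]
  refine mul_nonneg zero_le_two (integral_nonneg fun x ↦ ?_)
  exact mul_nonneg (sub_nonneg.2 (Real.cos_le_one _)) (sub_nonneg.2 (Real.cos_le_one _))

/-- If the real part of the exponent is quadratic, there are no jumps. -/
lemma IsLevyMeasure.eq_zero_of_re_levyExponent (hν : IsLevyMeasure ν)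
    (hi : ∀ z, Integrable (levyIntegrand h z) ν)
    (hq : ∀ z, (levyExponent h a v ν (z + z)).re = 4 * (levyExponent h a v ν z).re) : ν = 0 := by
  have i := integrable_one_sub_cos hi
  have key (z : ℝ) : ∀ᵐ x ∂ν, Real.cos (z * x) = 1 := by
    have h0 : ∫ x, (1 - Real.cos (z * x)) * (1 - Real.cos (z * x)) ∂ν = 0 := by
      have h1 := re_levyExponent_parallelogram (a := a) (v := v) hi z z
      have h2 : (levyExponent h a v ν (z - z)).re = 0 := by simp [re_levyExponent hi]
      have := hq z
      linarith
    rw [integral_eq_zero_iff_of_nonneg] at h0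
    · filter_upwards [h0] with x hx
      simp only [Pi.zero_apply, mul_self_eq_zero] at hx
      linarith
    · exact fun x ↦ mul_self_nonneg _
    -- `(1 - cos y)² = 2(1 - cos y) - (1 - cos 2y)/2`.
    · refine (((i z).const_mul 2).sub ((i (2 * z)).const_mul 2⁻¹)).congr (.of_forall fun x ↦ ?_)
      simp only [Pi.sub_apply]
      rw [mul_assoc 2 z x, Real.cos_two_mul]
      ring
  have h0 : ∀ᵐ x ∂ν, x ≠ 0 := by
    rw [ae_iff]
    simpa using hν.zero
  -- Countably many frequencies tending to `0` suffice: once `|x| < n`, the argument lies within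
  -- `(-2π, 2π)`, where `cos = 1` only at `0`.
  have hall : ∀ᵐ x ∂ν, ∀ n : ℕ, Real.cos ((n + 1 : ℝ)⁻¹ * x) = 1 := ae_all_iff.2 fun n ↦ key _
  rw [← ae_eq_bot, ← Filter.eventually_false_iff_eq_bot]
  filter_upwards [h0, hall] with x hx hc
  obtain ⟨n, hn⟩ := exists_nat_gt |x|
  have hpos : (0 : ℝ) < n + 1 := by positivity
  have hlt : |(n + 1 : ℝ)⁻¹ * x| < 2 * Real.pi := by
    rw [abs_mul, abs_of_pos (inv_pos.2 hpos), inv_mul_lt_iff₀ hpos]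
    nlinarith [Real.pi_gt_three]
  rw [abs_lt] at hlt
  have := (Real.cos_eq_one_iff_of_lt_of_lt hlt.1 hlt.2).1 (hc n)
  exact (mul_ne_zero (inv_ne_zero hpos.ne') hx) this

end Exponent

/-! ### Riemann sums and summation by parts on a uniform grid -/

section Grid

/-- The right endpoint of the cell containing `t` in the partition of `[0,T]` into `n + 1` cells. -/
noncomputable def gridRight (T : ℝ) (n : ℕ) (t : ℝ) : ℝ :=
  (⌊t / (T / (n + 1))⌋₊ + 1 : ℝ) * (T / (n + 1))

/-- `∫_s^T f`, with `f` cut off outside `[0,T]`. -/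
noncomputable def tailIntegral (T : ℝ) (f : ℝ → ℝ) (s : ℝ) : ℝ :=
  ∫ t in s..T, (Set.Icc 0 T).indicator f t

variable {𝕜 : Type*} [RCLike 𝕜] {T : ℝ}

lemma mesh_pos (hT : 0 < T) (n : ℕ) : 0 < T / (n + 1 : ℝ) := by positivity

lemma tendsto_mesh (T : ℝ) : Tendsto (fun n : ℕ ↦ T / (n + 1 : ℝ)) atTop (𝓝 0) :=
  tendsto_const_nhds.div_atTop (tendsto_atTop_add_const_right _ _ tendsto_natCast_atTop_atTop)

lemma lt_gridRight (hT : 0 < T) (n : ℕ) (t : ℝ) : t < gridRight T n t := by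
  rw [gridRight, ← div_lt_iff₀ (mesh_pos hT n)]
  exact Nat.lt_floor_add_one _

lemma gridRight_le (hT : 0 < T) (n : ℕ) {t : ℝ} (ht : 0 ≤ t) :
    gridRight T n t ≤ t + T / (n + 1) := by
  have hm := mesh_pos hT n
  have := Nat.floor_le (div_nonneg ht hm.le)
  rw [le_div_iff₀ hm] at this
  rw [gridRight, add_mul, one_mul]
  linarith

/-- At `t = T` the grid point overshoots `T`, so paths must be bounded on `[0, 2T]`. -/
lemma gridRight_mem (hT : 0 < T) (n : ℕ) {t : ℝ} (ht : t ∈ Set.Icc 0 T) :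
    gridRight T n t ∈ Set.Icc 0 (2 * T) := by
  refine ⟨ht.1.trans (lt_gridRight hT n t).le, (gridRight_le hT n ht.1).trans ?_⟩
  have : T / (n + 1 : ℝ) ≤ T := div_le_self hT.le (by linarith [n.cast_nonneg (α := ℝ)])
  linarith [ht.2]

lemma tendsto_gridRight (hT : 0 < T) {t : ℝ} (ht : 0 ≤ t) :
    Tendsto (fun n ↦ gridRight T n t) atTop (𝓝[≥] t) := by
  refine tendsto_nhdsWithin_iff.2 ⟨?_, .of_forall fun n ↦ (lt_gridRight hT n t).le⟩
  refine tendsto_of_tendsto_of_tendsto_of_le_of_le tendsto_const_nhds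
    (h := fun n : ℕ ↦ t + T / (n + 1)) ?_ (fun n ↦ (lt_gridRight hT n t).le) (fun n ↦ gridRight_le hT n ht)
  simpa using tendsto_const_nhds.add (tendsto_mesh T)

lemma measurable_comp_gridRight (x : ℝ → 𝕜) (n : ℕ) :
    Measurable fun t ↦ x (gridRight T n t) := by
  have : Measurable fun k : ℕ ↦ x ((k + 1 : ℝ) * (T / (n + 1))) := measurable_of_countable _
  exact this.comp (Nat.measurable_floor.comp (measurable_id.div_const _))

variable {x : ℝ → 𝕜} {f : ℝ → 𝕜}

lemma aestronglyMeasurable_of_rightContinuous (hT : 0 < T)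
    (hx : ∀ t, 0 ≤ t → ContinuousWithinAt x (Set.Ici t) t) :
    AEStronglyMeasurable x (volume.restrict (Set.Icc 0 T)) := by
  refine aestronglyMeasurable_of_tendsto_ae atTop (f := fun n t ↦ x (gridRight T n t))
    (fun n ↦ (measurable_comp_gridRight x n).aestronglyMeasurable) ?_
  filter_upwards [ae_restrict_mem measurableSet_Icc] with t ht
  exact (hx t ht.1).tendsto.comp (tendsto_gridRight hT ht.1)

lemma integrableOn_mul_of_rightContinuous (hT : 0 < T)
    (hx : ∀ t, 0 ≤ t → ContinuousWithinAt x (Set.Ici t) t) {M : ℝ}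
    (hM : ∀ t ∈ Set.Icc 0 (2 * T), ‖x t‖ ≤ M) (hf : IntegrableOn f (Set.Icc 0 T)) :
    IntegrableOn (fun t ↦ x t * f t) (Set.Icc 0 T) := by
  refine Integrable.bdd_mul (c := M) hf (aestronglyMeasurable_of_rightContinuous hT hx) ?_
  filter_upwards [ae_restrict_mem measurableSet_Icc] with t ht
  exact hM t ⟨ht.1, by linarith [ht.2]⟩

lemma tendsto_integral_gridRight (hT : 0 < T)
    (hx : ∀ t, 0 ≤ t → ContinuousWithinAt x (Set.Ici t) t) {M : ℝ}
    (hM : ∀ t ∈ Set.Icc 0 (2 * T), ‖x t‖ ≤ M) (hf : IntegrableOn f (Set.Icc 0 T)) :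
    Tendsto (fun n ↦ ∫ t in Set.Icc 0 T, x (gridRight T n t) * f t) atTop
      (𝓝 (∫ t in Set.Icc 0 T, x t * f t)) := by
  refine tendsto_integral_of_dominated_convergence (fun t ↦ M * ‖f t‖) (fun n ↦ ?_)
    (hf.norm.const_mul M) (fun n ↦ ?_) ?_
  · exact (measurable_comp_gridRight x n).aestronglyMeasurable.mul hf.aestronglyMeasurable
  · filter_upwards [ae_restrict_mem measurableSet_Icc] with t ht
    rw [norm_mul]
    gcongr
    exact hM _ (gridRight_mem hT n ht)
  · filter_upwards [ae_restrict_mem measurableSet_Icc] with t ht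
    exact ((hx t ht.1).tendsto.comp (tendsto_gridRight hT ht.1)).mul_const _

lemma gridRight_of_mem (hT : 0 < T) (n k : ℕ) {t : ℝ}
    (ht : t ∈ Set.Ico (k * (T / (n + 1))) ((k + 1 : ℕ) * (T / (n + 1)))) :
    gridRight T n t = (k + 1 : ℕ) * (T / (n + 1)) := by
  have hm := mesh_pos hT n
  have : ⌊t / (T / (n + 1 : ℝ))⌋₊ = k := by
    rw [Nat.floor_eq_iff (div_nonneg (le_trans (by positivity) ht.1) hm.le), le_div_iff₀ hm,
      div_lt_iff₀ hm]
    exact_mod_cast ht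
  rw [gridRight, this]
  push_cast
  rfl

lemma grid_subset (hT : 0 < T) {n k : ℕ} (hk : k < n + 1) :
    Set.Icc (k * (T / (n + 1))) ((k + 1 : ℕ) * (T / (n + 1))) ⊆ Set.Icc 0 T := by
  have hm := mesh_pos hT n
  refine Set.Icc_subset_Icc (by positivity) ?_
  have : ((k + 1 : ℕ) : ℝ) ≤ n + 1 := by exact_mod_cast hk
  calc ((k + 1 : ℕ) : ℝ) * (T / (n + 1)) ≤ (n + 1) * (T / (n + 1)) := by gcongr
    _ = T := by field_simp

lemma integral_gridRight (hT : 0 < T) (x : ℝ → 𝕜) (hf : IntegrableOn f (Set.Icc 0 T)) (n : ℕ) :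
    ∫ t in Set.Icc 0 T, x (gridRight T n t) * f t =
      ∑ k ∈ Finset.range (n + 1), x ((k + 1 : ℕ) * (T / (n + 1))) *
        ∫ t in (k * (T / (n + 1)))..((k + 1 : ℕ) * (T / (n + 1))), f t := by
  have hm := mesh_pos hT n
  have hle (k : ℕ) : (k : ℝ) * (T / (n + 1)) ≤ (k + 1 : ℕ) * (T / (n + 1)) := by
    gcongr; simp
  have hcell (k : ℕ) : ∀ t ∈ Set.Ioo ((k : ℝ) * (T / (n + 1))) ((k + 1 : ℕ) * (T / (n + 1))),
      x (gridRight T n t) * f t = x ((k + 1 : ℕ) * (T / (n + 1))) * f t := fun t ht ↦ by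
    rw [gridRight_of_mem hT n k ⟨ht.1.le, ht.2⟩]
  have hint (k : ℕ) (hk : k < n + 1) : IntervalIntegrable (fun t ↦ x (gridRight T n t) * f t)
      volume (k * (T / (n + 1))) ((k + 1 : ℕ) * (T / (n + 1))) := by
    rw [intervalIntegrable_iff_integrableOn_Ioo_of_le (hle k)]
    refine IntegrableOn.congr_fun (f := fun t ↦ x ((k + 1 : ℕ) * (T / (n + 1))) * f t) ?_
      (fun t ht ↦ (hcell k t ht).symm) measurableSet_Ioo
    exact Integrable.const_mul
      (hf.mono_set (Set.Ioo_subset_Icc_self.trans (grid_subset hT hk))) _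
  have hsum := intervalIntegral.sum_integral_adjacent_intervals
    (a := fun k : ℕ ↦ (k : ℝ) * (T / (n + 1))) (n := n + 1) hint
  have hend : ((n + 1 : ℕ) : ℝ) * (T / (n + 1)) = T := by push_cast; field_simp
  rw [hend, Nat.cast_zero, zero_mul, intervalIntegral.integral_of_le hT.le,
    ← integral_Icc_eq_integral_Ioc] at hsum
  rw [← hsum]
  refine Finset.sum_congr rfl fun k _ ↦ ?_
  rw [← intervalIntegral.integral_const_mul, intervalIntegral.integral_of_le (hle k),
    intervalIntegral.integral_of_le (hle k), integral_Ioc_eq_integral_Ioo,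
    integral_Ioc_eq_integral_Ioo]
  exact setIntegral_congr_fun measurableSet_Ioo (hcell k)

lemma sum_mul_sub_eq (x u : ℕ → 𝕜) (m : ℕ) :
    ∑ k ∈ Finset.range m, x (k + 1) * (u k - u (k + 1)) =
      (∑ k ∈ Finset.range m, (x (k + 1) - x k) * u k) + x 0 * u 0 - x m * u m := by
  induction m with
  | zero => simp
  | succ m ih =>
    rw [Finset.sum_range_succ, Finset.sum_range_succ, ih]
    ring

lemma integrable_indicator_Icc {g : ℝ → ℝ} (hg : IntegrableOn g (Set.Icc 0 T)) :
    Integrable ((Set.Icc 0 T).indicator g) :=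
  (integrable_indicator_iff measurableSet_Icc).2 hg

lemma continuous_tailIntegral {g : ℝ → ℝ} (hg : IntegrableOn g (Set.Icc 0 T)) :
    Continuous (tailIntegral T g) := by
  have : tailIntegral T g = fun s ↦ -∫ t in T..s, (Set.Icc 0 T).indicator g t := by
    funext s
    rw [tailIntegral, intervalIntegral.integral_symm]
  rw [this]
  exact (intervalIntegral.continuous_primitive
    (fun a b ↦ (integrable_indicator_Icc hg).intervalIntegrable) T).neg

lemma tailIntegral_sub {g : ℝ → ℝ} (hg : IntegrableOn g (Set.Icc 0 T)) {r s : ℝ} (hr : 0 ≤ r)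
    (hrs : r ≤ s) (hs : s ≤ T) :
    tailIntegral T g r - tailIntegral T g s = ∫ t in r..s, g t := by
  have hi := integrable_indicator_Icc hg
  rw [tailIntegral, tailIntegral, ← intervalIntegral.integral_add_adjacent_intervals
    (hi.intervalIntegrable (a := r) (b := s)) hi.intervalIntegrable, add_sub_cancel_right]
  refine intervalIntegral.integral_congr fun t ht ↦ ?_
  rw [Set.uIcc_of_le hrs] at ht
  exact Set.indicator_of_mem (Set.Icc_subset_Icc hr hs ht) g

/-- Abel summation of right-endpoint sums; both boundary terms vanish, since `x 0 = 0` and the tail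
integral is zero at `T`. -/
lemma tendsto_sum_increments {x g : ℝ → ℝ} (hT : 0 < T)
    (hx : ∀ t, 0 ≤ t → ContinuousWithinAt x (Set.Ici t) t) {M : ℝ}
    (hM : ∀ t ∈ Set.Icc 0 (2 * T), ‖x t‖ ≤ M) (hx0 : x 0 = 0)
    (hg : IntegrableOn g (Set.Icc 0 T)) :
    Tendsto (fun n : ℕ ↦ ∑ k ∈ Finset.range (n + 1),
      (x ((k + 1 : ℕ) * (T / (n + 1))) - x (k * (T / (n + 1)))) *
        tailIntegral T g (k * (T / (n + 1)))) atTop (𝓝 (∫ t in Set.Icc 0 T, x t * g t)) := by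
  refine (tendsto_integral_gridRight hT hx hM hg).congr fun n ↦ ?_
  have hm := mesh_pos hT n
  have hend : ((n + 1 : ℕ) : ℝ) * (T / (n + 1)) = T := by push_cast; field_simp
  have hu : tailIntegral T g T = 0 := intervalIntegral.integral_same
  rw [integral_gridRight hT x hg]
  have := sum_mul_sub_eq (fun k : ℕ ↦ x (k * (T / (n + 1))))
    (fun k : ℕ ↦ tailIntegral T g (k * (T / (n + 1)))) (n + 1)
  simp only [hend, hu, Nat.cast_zero, zero_mul, hx0, mul_zero, add_zero, sub_zero] at this
  rw [← this]
  refine Finset.sum_congr rfl fun k hk ↦ ?_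
  have hsub := grid_subset hT (Finset.mem_range.1 hk)
  have hle : (k : ℝ) * (T / (n + 1)) ≤ (k + 1 : ℕ) * (T / (n + 1)) := by
    gcongr; simp
  rw [tailIntegral_sub hg (hsub ⟨le_rfl, hle⟩).1 hle (hsub ⟨hle, le_rfl⟩).2]

lemma tendsto_riemann_sum {g : ℝ → ℂ} (hT : 0 < T) (hg : Continuous g) :
    Tendsto (fun n : ℕ ↦ ∑ k ∈ Finset.range (n + 1), ((T / (n + 1) : ℝ) : ℂ) *
      g (k * (T / (n + 1)))) atTop (𝓝 (∫ t in Set.Icc 0 T, g t)) := by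
  obtain ⟨M, hM⟩ := (isCompact_Icc (a := (0 : ℝ)) (b := 2 * T)).exists_bound_of_continuousOn
    hg.continuousOn
  have h1 := tendsto_integral_gridRight (f := fun _ ↦ (1 : ℂ)) hT
    (fun t _ ↦ hg.continuousWithinAt) hM (by simp)
  -- The difference between the left- and right-endpoint sums.
  have h2 : Tendsto (fun n : ℕ ↦ ((T / (n + 1) : ℝ) : ℂ) * (g 0 - g T)) atTop (𝓝 0) := by
    have := ((Complex.continuous_ofReal.tendsto 0).comp (tendsto_mesh T)).mul_const (g 0 - g T)
    simpa using this
  have h3 := h1.add h2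
  simp only [mul_one, add_zero] at h3
  refine h3.congr fun n ↦ ?_
  have hm := mesh_pos hT n
  have hend : ((n + 1 : ℕ) : ℝ) * (T / (n + 1)) = T := by push_cast; field_simp
  have h4 := integral_gridRight (f := fun _ ↦ (1 : ℂ)) hT g (by simp) n
  simp only [mul_one] at h4
  have h5 (k : ℕ) : ∫ _ in (k * (T / (n + 1)))..((k + 1 : ℕ) * (T / (n + 1))), (1 : ℂ) =
      ((T / (n + 1) : ℝ) : ℂ) := by
    rw [intervalIntegral.integral_const]
    simp only [Complex.real_smul, mul_one]
    push_cast
    ring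
  simp only [h5] at h4
  have h6 := Finset.sum_range_succ_sub_sum (fun k : ℕ ↦ g (k * (T / (n + 1)))) (n := n + 1)
  have h7 := Finset.sum_range_succ' (fun k : ℕ ↦ g (k * (T / (n + 1)))) (n + 1)
  rw [hend] at h6
  simp only [Nat.cast_zero, zero_mul] at h7
  rw [h4, ← Finset.sum_mul, ← Finset.mul_sum, mul_comm, ← mul_add]
  congr 1
  linear_combination h6 - h7

end Grid

/-! ### Characteristic functions of stochastic coefficients -/

section CharFun

/-- One-sided limits bound the path near each point; compactness makes the bound uniform. -/
lemma IsCadlag.exists_bound {x : ℝ≥0 → ℝ} (hx : IsCadlag x) (S : ℝ≥0) :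
    ∃ M, ∀ t ∈ Set.Icc 0 S, ‖x t‖ ≤ M := by
  refine IsCompact.induction_on (p := fun s ↦ ∃ M, ∀ t ∈ s, ‖x t‖ ≤ M) isCompact_Icc
    ⟨0, by simp⟩ (fun s t hst ⟨M, hM⟩ ↦ ⟨M, fun r hr ↦ hM r (hst hr)⟩) ?_ fun t _ ↦ ?_
  · rintro s t ⟨M, hM⟩ ⟨N, hN⟩
    exact ⟨max M N, fun r hr ↦ hr.elim (fun h ↦ (hM r h).trans (le_max_left _ _))
      fun h ↦ (hN r h).trans (le_max_right _ _)⟩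
  · obtain ⟨hr, l, hl⟩ := hx t
    have h1 : ∀ᶠ r in 𝓝[≥] t, ‖x r‖ < ‖x t‖ + 1 :=
      hr.norm.eventually_lt_const (lt_add_one _)
    have h2 : ∀ᶠ r in 𝓝[<] t, ‖x r‖ < ‖l‖ + 1 := hl.norm.eventually_lt_const (lt_add_one _)
    refine ⟨{r | ‖x r‖ ≤ max (‖l‖ + 1) (‖x t‖ + 1)}, mem_nhdsWithin_of_mem_nhds ?_, _,
      fun r hr ↦ hr⟩
    rw [← nhdsLT_sup_nhdsGE t]
    exact mem_sup.2 ⟨h2.mono fun r hr ↦ hr.le.trans (le_max_left _ _),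
      h1.mono fun r hr ↦ hr.le.trans (le_max_right _ _)⟩

lemma IsCadlag.continuousWithinAt_toNNReal {x : ℝ≥0 → ℝ} (hx : IsCadlag x) (t : ℝ) :
    ContinuousWithinAt (fun s : ℝ ↦ x s.toNNReal) (Set.Ici t) t :=
  ContinuousWithinAt.comp (hx t.toNNReal).1 continuous_real_toNNReal.continuousWithinAt
    fun _ hs ↦ Real.toNNReal_le_toNNReal hs

lemma IsCadlag.exists_bound_toNNReal {x : ℝ≥0 → ℝ} (hx : IsCadlag x) (S : ℝ) :
    ∃ M, ∀ t ∈ Set.Icc 0 S, ‖x t.toNNReal‖ ≤ M := by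
  obtain ⟨M, hM⟩ := hx.exists_bound S.toNNReal
  exact ⟨M, fun t ht ↦ hM _ ⟨zero_le, Real.toNNReal_le_toNNReal ht.2⟩⟩

variable {Ω : Type*} [MeasurableSpace Ω] {P : Measure Ω} {X : ℝ≥0 → Ω → ℝ} {T : ℝ}

/-- The time `kT/(n+1)`. -/
noncomputable def gridTime (T : ℝ) (n k : ℕ) : ℝ≥0 := ((k : ℝ) * (T / (n + 1))).toNNReal

lemma coe_gridTime (hT : 0 < T) (n k : ℕ) : (gridTime T n k : ℝ) = k * (T / (n + 1)) :=
  Real.coe_toNNReal _ (by positivity)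

lemma gridTime_succ (hT : 0 < T) (n k : ℕ) :
    gridTime T n (k + 1) = gridTime T n k + (T / (n + 1)).toNNReal := by
  rw [gridTime, gridTime, ← Real.toNNReal_add (by positivity) (by positivity)]
  push_cast
  ring_nf

lemma monotone_gridTime (hT : 0 < T) (n : ℕ) : Monotone (gridTime T n) :=
  monotone_nat_of_le_succ fun k ↦ by rw [gridTime_succ hT]; exact le_self_add

/-- The discretization of `∫_0^T X_t f(t) dt`, summed by parts. -/
noncomputable def gridCoeff (X : ℝ≥0 → Ω → ℝ) (T : ℝ) (f : ℝ → ℝ) (n : ℕ) (ω : Ω) : ℝ :=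
  ∑ k ∈ Finset.range (n + 1), (X (gridTime T n (k + 1)) ω - X (gridTime T n k) ω) *
    tailIntegral T f (k * (T / (n + 1)))

variable {f : ℝ → ℝ}

lemma IsLevyProcess.measurable_gridCoeff (hX : IsLevyProcess X P) (n : ℕ) :
    Measurable (gridCoeff X T f n) :=
  Finset.measurable_fun_sum _ fun _ _ ↦
    ((hX.measurable _).sub (hX.measurable _)).mul_const _

lemma IsLevyProcess.tendsto_gridCoeff (hX : IsLevyProcess X P) (hT : 0 < T)
    (hf : IntegrableOn f (Set.Icc 0 T)) :
    ∀ᵐ ω ∂P, Tendsto (fun n ↦ gridCoeff X T f n ω) atTop (𝓝 (stochCoeff X T f ω)) := by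
  filter_upwards [hX.zero, hX.cadlag] with ω h0 hc
  obtain ⟨M, hM⟩ := hc.exists_bound_toNNReal (2 * T)
  exact tendsto_sum_increments hT (fun t _ ↦ hc.continuousWithinAt_toNNReal t) hM (by simpa) hf

lemma IsLevyProcess.aemeasurable_stochCoeff (hX : IsLevyProcess X P) (hT : 0 < T)
    (hf : IntegrableOn f (Set.Icc 0 T)) : AEMeasurable (stochCoeff X T f) P :=
  aemeasurable_of_tendsto_metrizable_ae atTop
    (fun n ↦ (hX.measurable_gridCoeff n).aemeasurable) (hX.tendsto_gridCoeff hT hf)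

lemma IsLevyProcess.stochCoeff_sum (hX : IsLevyProcess X P) (hT : 0 < T) {ι : Type*}
    (s : Finset ι) (c : ι → ℝ) (e : ι → ℝ → ℝ) (he : ∀ i, IntegrableOn (e i) (Set.Icc 0 T)) :
    ∀ᵐ ω ∂P, stochCoeff X T (fun t ↦ ∑ i ∈ s, c i * e i t) ω =
      ∑ i ∈ s, c i * stochCoeff X T (e i) ω := by
  filter_upwards [hX.cadlag] with ω hc
  obtain ⟨M, hM⟩ := hc.exists_bound_toNNReal (2 * T)
  have hi (i : ι) := integrableOn_mul_of_rightContinuous hT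
    (fun t _ ↦ hc.continuousWithinAt_toNNReal t) hM (he i)
  simp only [stochCoeff, Finset.mul_sum]
  rw [integral_finsetSum _ fun i _ ↦ ?_]
  · refine Finset.sum_congr rfl fun i _ ↦ ?_
    rw [← integral_const_mul]
    exact integral_congr_ae (.of_forall fun t ↦ by ring)
  · exact ((hi i).const_mul (c i)).congr (.of_forall fun t ↦ by ring)

variable {h : ℝ → ℝ} {a : ℝ} {v : ℝ≥0} {ν : Measure ℝ}

lemma integral_exp_increment (hX : IsLevyProcess X P) (hν : HasGeneratingTriple X P h a v ν)
    (s t : ℝ≥0) (z : ℝ) :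
    ∫ ω, Complex.exp (Complex.I * z * (X (s + t) ω - X s ω : ℝ)) ∂P =
      Complex.exp (-(t : ℂ) * levyExponent h a v ν z) := by
  rw [← hν.charFun_eq t z]
  have h1 := ((hX.stationary s t).comp
    (u := fun x : ℝ ↦ Complex.exp (Complex.I * z * x)) (by fun_prop)).integral_eq
  refine h1.trans (integral_congr_ae ?_)
  filter_upwards [hX.zero] with ω h0
  simp [h0]

lemma integral_exp_gridCoeff (hX : IsLevyProcess X P) (hν : HasGeneratingTriple X P h a v ν)
    (hT : 0 < T) (f : ℝ → ℝ) (n : ℕ) :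
    ∫ ω, Complex.exp (Complex.I * gridCoeff X T f n ω) ∂P =
      Complex.exp (-∑ k ∈ Finset.range (n + 1), ((T / (n + 1) : ℝ) : ℂ) *
        levyExponent h a v ν (tailIntegral T f (k * (T / (n + 1))))) := by
  have hind := hX.indep (n + 1) (fun k ↦ gridTime T n k)
    ((monotone_gridTime hT n).comp Fin.val_strictMono.monotone)
  have h1 := hind.integral_fun_prod_comp
    (f := fun (k : Fin (n + 1)) (x : ℝ) ↦
      Complex.exp (Complex.I * tailIntegral T f (k * (T / (n + 1))) * x))
    (fun i ↦ ((hX.measurable _).sub (hX.measurable _)).aemeasurable)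
    (fun i ↦ by fun_prop)
  have h2 (ω : Ω) : Complex.exp (Complex.I * gridCoeff X T f n ω) = ∏ k : Fin (n + 1),
      Complex.exp (Complex.I * tailIntegral T f (k * (T / (n + 1))) *
        (X (gridTime T n k.succ) ω - X (gridTime T n k.castSucc) ω : ℝ)) := by
    rw [← Complex.exp_sum, gridCoeff, Finset.sum_range, Complex.ofReal_sum, Finset.mul_sum]
    congr 1
    refine Finset.sum_congr rfl fun k _ ↦ ?_
    rw [Complex.ofReal_mul, mul_assoc, mul_comm ((tailIntegral T f _ : ℝ) : ℂ)]
    simp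
  simp only [h2]
  rw [h1, ← Finset.sum_neg_distrib, Complex.exp_sum, Finset.prod_range]
  refine Finset.prod_congr rfl fun k _ ↦ ?_
  have h3 := integral_exp_increment hX hν (gridTime T n k) (T / (n + 1)).toNNReal
    (tailIntegral T f (k * (T / (n + 1))))
  rw [← gridTime_succ hT] at h3
  have h4 : (((T / (n + 1)).toNNReal : ℝ≥0) : ℂ) = ((T / (n + 1) : ℝ) : ℂ) :=
    congrArg Complex.ofReal (Real.coe_toNNReal _ (mesh_pos hT n).le)
  rw [h4, neg_mul] at h3
  exact h3

/-- The characteristic function of a stochastic coefficient. -/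
theorem integral_exp_stochCoeff [IsProbabilityMeasure P] (hX : IsLevyProcess X P)
    (hν : HasGeneratingTriple X P h a v ν) (hT : 0 < T) (hf : IntegrableOn f (Set.Icc 0 T)) :
    ∫ ω, Complex.exp (Complex.I * stochCoeff X T f ω) ∂P =
      Complex.exp (-∫ t in Set.Icc 0 T, levyExponent h a v ν (tailIntegral T f t)) := by
  have hΨ : Continuous (levyExponent h a v ν) :=
    continuous_levyExponent hν.isLevyMeasure hν.integrable
  have h1 := tendsto_riemann_sum hT (hΨ.comp (continuous_tailIntegral hf))
  have h2 := (Complex.continuous_exp.tendsto _).comp h1.neg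
  have h3 : Tendsto (fun n ↦ ∫ ω, Complex.exp (Complex.I * gridCoeff X T f n ω) ∂P) atTop
      (𝓝 (∫ ω, Complex.exp (Complex.I * stochCoeff X T f ω) ∂P)) := by
    refine tendsto_integral_of_dominated_convergence (fun _ ↦ 1) (fun n ↦ ?_)
      (integrable_const 1) (fun n ↦ .of_forall fun ω ↦ ?_) ?_
    · have := hX.measurable_gridCoeff (T := T) (f := f) n
      exact Measurable.aestronglyMeasurable (by fun_prop)
    · rw [Complex.norm_exp_I_mul_ofReal]
    · filter_upwards [hX.tendsto_gridCoeff hT hf] with ω hω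
      exact ((show Continuous fun x : ℝ ↦ Complex.exp (Complex.I * x) by fun_prop).tendsto _).comp
        hω
  refine tendsto_nhds_unique h3 (h2.congr fun n ↦ ?_)
  exact (integral_exp_gridCoeff hX hν hT f n).symm

lemma tailIntegral_sum {ι : Type*} (s : Finset ι) (c : ι → ℝ) (e : ι → ℝ → ℝ)
    (he : ∀ i, IntegrableOn (e i) (Set.Icc 0 T)) (r : ℝ) :
    tailIntegral T (fun t ↦ ∑ i ∈ s, c i * e i t) r = ∑ i ∈ s, c i * tailIntegral T (e i) r := by
  simp only [tailIntegral]
  simp_rw [← intervalIntegral.integral_const_mul]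
  rw [← intervalIntegral.integral_finsetSum fun i _ ↦
    ((integrable_indicator_Icc (he i)).const_mul _).intervalIntegrable]
  congr 1
  funext t
  by_cases ht : t ∈ Set.Icc 0 T <;> simp [ht]

end CharFun

/-! ### The covariance function `Var X₁ · min s t` -/

section Covariance

/-- Nonnegativity makes `φ` monotone. Trapping `n * t` between consecutive integers bounds `n |φ t -
φ 1 * t|` by `φ 1` for all `n`. -/
lemma eq_mul_of_additive {φ : ℝ≥0 → ℝ} (h0 : ∀ t, 0 ≤ φ t) (hadd : ∀ s t, φ (s + t) = φ s + φ t)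
    (t : ℝ≥0) : φ t = φ 1 * t := by
  have hmono : Monotone φ := fun s t hst ↦ by
    obtain ⟨r, rfl⟩ := exists_add_of_le hst
    linarith [hadd s r, h0 r]
  have hz : φ 0 = 0 := by simpa using hadd 0 0
  have hn (n : ℕ) (t : ℝ≥0) : φ (n * t) = n * φ t := by
    induction n with
    | zero => simp [hz]
    | succ n ih =>
      push_cast
      rw [add_mul, one_mul, hadd, ih]
      ring
  have key (n : ℕ) : n * |φ t - φ 1 * t| ≤ φ 1 := by
    have h1 := hmono (Nat.floor_le (zero_le (a := (n : ℝ≥0) * t)))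
    have h2 := hmono (Nat.lt_floor_add_one ((n : ℝ≥0) * t)).le
    have h3 := hn ⌊(n : ℝ≥0) * t⌋₊ 1
    rw [mul_one] at h3
    rw [hadd, h3] at h2
    rw [h3] at h1
    rw [hn] at h1 h2
    have h4 : (⌊(n : ℝ≥0) * t⌋₊ : ℝ) ≤ n * t := by
      exact_mod_cast Nat.floor_le (zero_le (a := (n : ℝ≥0) * t))
    have h5 : (n : ℝ) * t ≤ ⌊(n : ℝ≥0) * t⌋₊ + 1 := by
      exact_mod_cast (Nat.lt_floor_add_one ((n : ℝ≥0) * t)).le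
    have h6 := h0 1
    rw [← abs_of_nonneg (n.cast_nonneg (α := ℝ)), ← abs_mul, abs_le]
    constructor <;> nlinarith
  by_contra hne
  have hpos : 0 < |φ t - φ 1 * t| := abs_pos.2 (sub_ne_zero.2 hne)
  obtain ⟨n, hn'⟩ := exists_nat_gt (φ 1 / |φ t - φ 1 * t|)
  rw [div_lt_iff₀ hpos] at hn'
  exact absurd (key n) (not_le.2 hn')

variable {Ω : Type*} [MeasurableSpace Ω] {P : Measure Ω} {X : ℝ≥0 → Ω → ℝ}

lemma IsCenteredSquareIntegrableLevy.variance_eq (hX : IsCenteredSquareIntegrableLevy X P)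
    (t : ℝ≥0) : Var[X t; P] = Var[X 1; P] * t := by
  refine eq_mul_of_additive (φ := fun t ↦ Var[X t; P]) (fun t ↦ variance_nonneg _ _)
    (fun s t ↦ ?_) t
  have h1 : X (s + t) = X s + (X (s + t) - X s) := by abel
  have hind := hX.indep.indepFun_eval_sub (zero_le (a := s)) (le_self_add (b := t)) hX.zero
  have h2 : Var[X (s + t) - X s; P] = Var[X t; P] := by
    refine (hX.stationary s t).variance_eq.trans (variance_congr ?_)
    filter_upwards [hX.zero] with ω h0
    simp [h0]
  conv_lhs => rw [h1]
  rw [IndepFun.variance_add (hX.memLp s) ((hX.memLp _).sub (hX.memLp s)) hind, h2]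

lemma IsCenteredSquareIntegrableLevy.covariance_eq [IsProbabilityMeasure P]
    (hX : IsCenteredSquareIntegrableLevy X P)
    (s t : ℝ≥0) : cov[X s, X t; P] = Var[X 1; P] * (min s t : ℝ≥0) := by
  wlog hst : s ≤ t generalizing s t
  · rw [covariance_comm, min_comm]
    exact this t s (le_of_not_ge hst)
  have h1 : X t = X s + (X t - X s) := by abel
  have hind := hX.indep.indepFun_eval_sub (zero_le (a := s)) hst hX.zero
  have hsub : MemLp (X t - X s) 2 P := (hX.memLp t).sub (hX.memLp s)
  rw [min_eq_left hst, h1, covariance_add_right (hX.memLp s) (hX.memLp s) hsub,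
    hind.covariance_eq_zero (hX.memLp s) hsub, add_zero,
    covariance_self (hX.memLp s).aemeasurable, hX.variance_eq]

end Covariance

/-! ### The Volterra operator and its adjoint -/

section Volterra

variable {T : ℝ} {f g : ℝ → ℝ}

lemma setIntegral_Iio_indicator (g : ℝ → ℝ) {s : ℝ} (hs : s ∈ Set.Icc 0 T) :
    ∫ r in Set.Icc 0 T, (Set.Iio s).indicator g r = ∫ r in (0 : ℝ)..s, g r := by
  have : Set.Icc 0 T ∩ Set.Iio s = Set.Ico 0 s := by
    ext r
    simp only [Set.mem_inter_iff, Set.mem_Icc, Set.mem_Iio, Set.mem_Ico]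
    exact ⟨fun h ↦ ⟨h.1.1, h.2⟩, fun h ↦ ⟨⟨h.1, h.2.le.trans hs.2⟩, h.2⟩⟩
  rw [setIntegral_indicator measurableSet_Iio, this, intervalIntegral.integral_of_le hs.1,
    integral_Ioc_eq_integral_Ioo, integral_Ico_eq_integral_Ioo]

lemma setIntegral_Ioi_indicator (f : ℝ → ℝ) {r : ℝ} (hr : r ∈ Set.Icc 0 T) :
    ∫ s in Set.Icc 0 T, (Set.Ioi r).indicator f s = tailIntegral T f r := by
  rw [tailIntegral, intervalIntegral.integral_of_le hr.2,
    setIntegral_indicator measurableSet_Ioi, setIntegral_indicator measurableSet_Icc]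
  congr 2
  ext s
  simp only [Set.mem_inter_iff, Set.mem_Icc, Set.mem_Ioi, Set.mem_Ioc]
  have := hr.1
  grind

/-- Fubini on the triangle `r < s`. -/
lemma integral_mul_primitive (hf : IntegrableOn f (Set.Icc 0 T))
    (hg : IntegrableOn g (Set.Icc 0 T)) :
    ∫ s in Set.Icc 0 T, f s * ∫ r in (0 : ℝ)..s, g r =
      ∫ r in Set.Icc 0 T, g r * tailIntegral T f r := by
  have h1 : ∫ s in Set.Icc 0 T, f s * ∫ r in (0 : ℝ)..s, g r =
      ∫ s in Set.Icc 0 T, ∫ r in Set.Icc 0 T, {p : ℝ × ℝ | p.2 < p.1}.indicator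
        (fun p ↦ f p.1 * g p.2) (s, r) := by
    refine setIntegral_congr_fun measurableSet_Icc fun s hs ↦ ?_
    rw [← setIntegral_Iio_indicator g hs, ← integral_const_mul]
    congr 1
    funext r
    by_cases hrs : r < s <;> simp [hrs]
  have h2 : ∫ r in Set.Icc 0 T, g r * tailIntegral T f r =
      ∫ r in Set.Icc 0 T, ∫ s in Set.Icc 0 T, {p : ℝ × ℝ | p.2 < p.1}.indicator
        (fun p ↦ f p.1 * g p.2) (s, r) := by
    refine setIntegral_congr_fun measurableSet_Icc fun r hr ↦ ?_
    rw [← setIntegral_Ioi_indicator f hr, ← integral_const_mul]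
    congr 1
    funext s
    by_cases hrs : r < s <;> simp [hrs, mul_comm]
  rw [h1, h2]
  refine integral_integral_swap ?_
  exact (Integrable.mul_prod hf hg).indicator (measurableSet_lt measurable_snd measurable_fst)

/-- As a function of `t`, `min s t` is the primitive of the indicator of `r < s`. -/
lemma integral_min_mul (hf : IntegrableOn f (Set.Icc 0 T)) {s : ℝ} (hs : s ∈ Set.Icc 0 T) :
    ∫ t in Set.Icc 0 T, min s t * f t = ∫ r in (0 : ℝ)..s, tailIntegral T f r := by
  have h1 := integral_mul_primitive (g := (Set.Iio s).indicator fun _ ↦ (1 : ℝ)) hf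
    ((integrable_const 1).indicator measurableSet_Iio)
  have h2 : ∫ r in Set.Icc 0 T, (Set.Iio s).indicator (fun _ ↦ (1 : ℝ)) r * tailIntegral T f r =
      ∫ r in (0 : ℝ)..s, tailIntegral T f r := by
    rw [← setIntegral_Iio_indicator _ hs]
    congr 1
    funext r
    by_cases hrs : r < s <;> simp [hrs]
  rw [← h2, ← h1]
  refine setIntegral_congr_fun measurableSet_Icc fun t ht ↦ ?_
  have h3 : ∫ r in (0 : ℝ)..t, (Set.Iio s).indicator (fun _ ↦ (1 : ℝ)) r = min s t := by
    have : Set.Ico 0 t ∩ Set.Iio s = Set.Ico 0 (min t s) := Set.Ico_inter_Iio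
    rw [intervalIntegral.integral_of_le ht.1, integral_Ioc_eq_integral_Ioo,
      ← integral_Ico_eq_integral_Ioo, setIntegral_indicator measurableSet_Iio, this]
    simp [min_comm, hs.1, ht.1]
  simp only [h3, mul_comm]

end Volterra

/-! ### Eigenfunctions of the covariance operator -/

section Eigenfunctions

variable {Ω : Type*} [MeasurableSpace Ω] {P : Measure Ω} [IsProbabilityMeasure P]
  {X : ℝ≥0 → Ω → ℝ} {T : ℝ} {e : HilbertBasis ℕ ℝ (L2 T)} {lam : ℕ → ℝ}

lemma integrableOn_L2 (f : L2 T) : IntegrableOn f (Set.Icc 0 T) :=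
  (Lp.memLp f).integrable one_le_two

lemma integral_mul_basis (e : HilbertBasis ℕ ℝ (L2 T)) (j k : ℕ) :
    ∫ t in Set.Icc 0 T, e j t * e k t = if j = k then 1 else 0 := by
  rw [← orthonormal_iff_ite.1 e.orthonormal j k, L2.inner_def]
  congr 1
  funext t
  simp [mul_comm]

lemma IsKLBasis.eigen_eq (hX : IsCenteredSquareIntegrableLevy X P) (he : IsKLBasis X P T e lam)
    (k : ℕ) : ∀ᵐ s ∂volume.restrict (Set.Icc 0 T),
      lam k * e k s = Var[X 1; P] * ∫ r in (0 : ℝ)..s, tailIntegral T (e k) r := by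
  filter_upwards [he.eigen k, ae_restrict_mem measurableSet_Icc] with s hs hsT
  rw [← hs, covOperator, ← integral_min_mul (integrableOn_L2 (e k)) hsT, ← integral_const_mul]
  refine setIntegral_congr_fun measurableSet_Icc fun t ht ↦ ?_
  simp only [hX.covariance_eq, NNReal.coe_min, Real.coe_toNNReal _ hsT.1,
    Real.coe_toNNReal _ ht.1, mul_assoc]

/-- Pair the integrated eigenrelation with `e j` and move the primitive to the other factor. -/
lemma IsKLBasis.integral_tail_mul_tail (hX : IsCenteredSquareIntegrableLevy X P)
    (he : IsKLBasis X P T e lam) (j k : ℕ) :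
    Var[X 1; P] * ∫ t in Set.Icc 0 T, tailIntegral T (e j) t * tailIntegral T (e k) t =
      if j = k then lam k else 0 := by
  have hk := continuous_tailIntegral (integrableOn_L2 (e k))
  have h1 := integral_mul_primitive (integrableOn_L2 (e j))
    (hk.continuousOn.integrableOn_compact (isCompact_Icc (a := 0) (b := T)))
  have h2 : ∫ s in Set.Icc 0 T, e j s * (lam k * e k s) =
      ∫ s in Set.Icc 0 T, Var[X 1; P] * (e j s * ∫ r in (0 : ℝ)..s, tailIntegral T (e k) r) := by
    refine integral_congr_ae ?_
    filter_upwards [he.eigen_eq hX k] with s hs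
    rw [hs]
    ring
  rw [integral_const_mul, h1] at h2
  simp only [mul_comm (tailIntegral T (e j) _)]
  rw [← h2]
  simp only [mul_left_comm _ (lam k)]
  rw [integral_const_mul, integral_mul_basis]
  simp

lemma ae_eq_zero_of_tailIntegral_eq_zero {f : ℝ → ℝ} (hf : IntegrableOn f (Set.Icc 0 T))
    (h : ∀ t ∈ Set.Ioo 0 T, tailIntegral T f t = 0) :
    ∀ᵐ t ∂volume.restrict (Set.Icc 0 T), f t = 0 := by
  have hi := integrable_indicator_Icc hf
  rw [← restrict_Ioo_eq_restrict_Icc]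
  filter_upwards [ae_restrict_of_ae (LocallyIntegrable.ae_hasDerivAt_integral hi.locallyIntegrable),
    ae_restrict_mem measurableSet_Ioo] with t ht htT
  have h1 := ht T
  have h2 : HasDerivAt (fun s ↦ ∫ r in T..s, (Set.Icc 0 T).indicator f r) 0 t := by
    refine (hasDerivAt_const t (0 : ℝ)).congr_of_eventuallyEq ?_
    filter_upwards [isOpen_Ioo.mem_nhds htT] with s hs
    rw [intervalIntegral.integral_symm, neg_eq_zero]
    exact h s hs
  rw [← h1.unique h2, Set.indicator_of_mem (Set.Ioo_subset_Icc_self htT)]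

/-- The tail integrals of the eigenfunctions do not vanish at the origin. -/
lemma IsKLBasis.tailIntegral_zero_ne (hX : IsCenteredSquareIntegrableLevy X P)
    (he : IsKLBasis X P T e lam) (hc : Var[X 1; P] ≠ 0) (k : ℕ) :
    tailIntegral T (e k) 0 ≠ 0 := by
  intro hu0
  set c := Var[X 1; P]
  have hc0 : 0 < c := (variance_nonneg _ _).lt_of_ne' hc
  set u := tailIntegral T (e k)
  have hint := integrableOn_L2 (e k)
  have hu : Continuous u := continuous_tailIntegral hint
  set W : ℝ → ℝ := fun s ↦ ∫ r in (0 : ℝ)..s, u r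
  have hW (s : ℝ) : HasDerivAt W (u s) s := (hu.integral_hasStrictDerivAt 0 s).hasDerivAt
  have hWc : Continuous W := continuous_iff_continuousAt.2 fun s ↦ (hW s).continuousAt
  set V : ℝ → ℝ := fun s ↦ ∫ r in (0 : ℝ)..s, W r
  have hV (s : ℝ) : HasDerivAt V (W s) s := (hWc.integral_hasStrictDerivAt 0 s).hasDerivAt
  have hlam : 0 ≤ lam k := by
    have := he.integral_tail_mul_tail hX k k
    rw [if_pos rfl] at this
    rw [← this]
    exact mul_nonneg hc0.le (integral_nonneg fun t ↦ mul_self_nonneg _)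
  -- The eigenrelation `lam k * e k = c * W`, integrated from `0`, where `u` is assumed to vanish.
  have hVu : ∀ s ∈ Set.Icc 0 T, lam k * u s = -(c * V s) := fun s hs ↦ by
    have h1 := tailIntegral_sub hint le_rfl hs.1 hs.2
    have h2 : lam k * ∫ r in (0 : ℝ)..s, e k r = c * V s := by
      rw [← intervalIntegral.integral_const_mul, ← intervalIntegral.integral_const_mul,
        intervalIntegral.integral_of_le hs.1, intervalIntegral.integral_of_le hs.1]
      refine integral_congr_ae ?_
      exact ae_restrict_of_ae_restrict_of_subset
        (Set.Ioc_subset_Icc_self.trans (Set.Icc_subset_Icc_right hs.2)) (he.eigen_eq hX k)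
    have h3 : u s = -∫ r in (0 : ℝ)..s, e k r := by
      change tailIntegral T (e k) s = _
      linarith
    rw [h3, ← h2]
    ring
  -- A conserved energy: its derivative is `2cW(cV + lam k * u) = 0`, and `V` and `W` vanish at `0`.
  have hE : ∀ s ∈ Set.Icc 0 T, c ^ 2 * V s ^ 2 + c * lam k * W s ^ 2 = 0 := by
    have hd (s : ℝ) : HasDerivAt (fun s ↦ c ^ 2 * V s ^ 2 + c * lam k * W s ^ 2)
        (c ^ 2 * (2 * V s * W s) + c * lam k * (2 * W s * u s)) s := by
      have h1 := ((hV s).pow 2).const_mul (c ^ 2)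
      have h2 := ((hW s).pow 2).const_mul (c * lam k)
      simpa using h1.fun_add h2
    have := constant_of_has_deriv_right_zero (f := fun s ↦ c ^ 2 * V s ^ 2 + c * lam k * W s ^ 2)
      (a := 0) (b := T) (fun s _ ↦ (hd s).continuousAt.continuousWithinAt) fun s hs ↦ by
        have h1 := (hd s).hasDerivWithinAt (s := Set.Ici s)
        have h2 := hVu s ⟨hs.1, hs.2.le⟩
        convert! h1 using 1
        linear_combination (-(c * 2 * W s)) * h2
    intro s hs
    simpa [V, W] using this s hs
  have hV0 : ∀ s ∈ Set.Icc 0 T, V s = 0 := fun s hs ↦ by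
    have h1 := hE s hs
    have h2 : 0 ≤ c * lam k * W s ^ 2 := by positivity
    have h3 : c ^ 2 * V s ^ 2 = 0 := le_antisymm (by linarith) (by positivity)
    simpa [hc0.ne'] using h3
  -- Differentiating `V = 0` twice gives `u = 0` even if `lam k = 0`; then `e k = 0`, against unit
  -- norm.
  have hloc {F F' : ℝ → ℝ} (hF : ∀ s, HasDerivAt F (F' s) s) (h0 : ∀ s ∈ Set.Ioo 0 T, F s = 0) :
      ∀ s ∈ Set.Ioo 0 T, F' s = 0 := fun s hs ↦
    (hF s).unique ((hasDerivAt_const s (0 : ℝ)).congr_of_eventuallyEq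
      ((isOpen_Ioo.mem_nhds hs |> eventually_of_mem <| h0)))
  have hu00 := hloc hW (hloc hV fun s hs ↦ hV0 s (Set.Ioo_subset_Icc_self hs))
  have he0 := ae_eq_zero_of_tailIntegral_eq_zero hint hu00
  have h1 := integral_mul_basis e k k
  rw [if_pos rfl, integral_eq_zero_of_ae] at h1
  · exact zero_ne_one h1
  · filter_upwards [he0] with t ht
    simp [ht]

end Eigenfunctions

/-! ### Path continuity from Gaussian increments -/

section Continuity

/-- Being in all `B n` from some `N` on has probability at most each later `P (B n)`; no summability
is needed. -/
lemma ae_frequently_notMem {Ω : Type*} [MeasurableSpace Ω] {P : Measure Ω} {B : ℕ → Set Ω}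
    (hB : Tendsto (fun n ↦ P (B n)) atTop (𝓝 0)) : ∀ᵐ ω ∂P, ∃ᶠ n in atTop, ω ∉ B n := by
  have h1 : {ω | ¬ ∃ᶠ n in atTop, ω ∉ B n} = ⋃ N, ⋂ n ≥ N, B n := by
    ext ω
    simp [Filter.Frequently, eventually_atTop]
  rw [ae_iff, h1, measure_iUnion_null_iff]
  intro N
  refine le_antisymm (ge_of_tendsto hB ?_) zero_le
  filter_upwards [eventually_ge_atTop N] with n hn
  exact measure_mono (Set.biInter_subset_of_mem hn)

/-- A two-sided Chernoff bound. The larger proxy `w'` keeps the exponent meaningful when `w = 0`. -/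
lemma gaussianReal_abs_ge_le {w w' : ℝ≥0} (hw : w ≤ w') {ε : ℝ} (hε : 0 ≤ ε) :
    (gaussianReal 0 w).real {x | ε ≤ |x|} ≤ 2 * Real.exp (-ε ^ 2 / (2 * w')) := by
  have hs : HasSubgaussianMGF id w' (gaussianReal 0 w) := by
    refine ⟨fun t ↦ integrable_exp_mul_gaussianReal t, fun t ↦ ?_⟩
    rw [mgf_id_gaussianReal]
    simp only [zero_mul, zero_add]
    gcongr
  have h1 := hs.measure_ge_le hε
  have h2 := hs.neg.measure_ge_le hε
  have h3 : {x : ℝ | ε ≤ |x|} ⊆ {x | ε ≤ id x} ∪ {x | ε ≤ (-id) x} := fun x hx ↦ by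
    simpa [le_abs] using hx
  have h4 := (measureReal_mono h3 (measure_ne_top (gaussianReal 0 w) _)).trans
    (measureReal_union_le _ _)
  linarith

variable {T : ℝ}

lemma exists_grid_around (hT : 0 < T) {t : ℝ≥0} (ht : 0 < t) (htT : (t : ℝ) ≤ T) (n : ℕ) :
    ∃ k < n + 1, gridTime T n k < t ∧ t ≤ gridTime T n (k + 1) := by
  have hm := mesh_pos hT n
  have hc : 0 < ⌈(t : ℝ) / (T / (n + 1))⌉₊ := Nat.ceil_pos.2 (div_pos ht hm)
  obtain ⟨k, hk⟩ := Nat.exists_eq_succ_of_ne_zero hc.ne'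
  rw [Nat.succ_eq_add_one, Nat.ceil_eq_iff (Nat.succ_ne_zero k), lt_div_iff₀ hm,
    div_le_iff₀ hm] at hk
  refine ⟨k, ?_, ?_, ?_⟩
  · have h1 : (k : ℝ) * (T / (n + 1)) < (n + 1) * (T / (n + 1)) := by
      have : (n + 1 : ℝ) * (T / (n + 1)) = T := by field_simp
      rw [this]
      exact lt_of_lt_of_le (by simpa using hk.1) htT
    exact_mod_cast lt_of_mul_lt_mul_right h1 hm.le
  · rw [← NNReal.coe_lt_coe, coe_gridTime hT]
    simpa using hk.1
  · rw [← NNReal.coe_le_coe, coe_gridTime hT]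
    exact hk.2

/-- A jump of a càdlàg path is seen by all sufficiently fine grids. -/
lemma eventually_exists_large_increment {x : ℝ≥0 → ℝ} {t : ℝ≥0} {l ε : ℝ} (hT : 0 < T)
    (ht : 0 < t) (htT : (t : ℝ) ≤ T) (hr : ContinuousWithinAt x (Set.Ici t) t)
    (hl : Tendsto x (𝓝[<] t) (𝓝 l)) (hε : ε < |x t - l|) :
    ∀ᶠ n in atTop, ∃ k < n + 1, ε ≤ |x (gridTime T n (k + 1)) - x (gridTime T n k)| := by
  choose k hk hlt hle using exists_grid_around hT ht htT
  have hmesh : Tendsto (fun n : ℕ ↦ (T / (n + 1)).toNNReal) atTop (𝓝 0) := by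
    simpa [Function.comp_def] using (continuous_real_toNNReal.tendsto 0).comp (tendsto_mesh T)
  have hb : Tendsto (fun n ↦ gridTime T n (k n + 1)) atTop (𝓝 t) := by
    refine tendsto_of_tendsto_of_tendsto_of_le_of_le tendsto_const_nhds
      (h := fun n : ℕ ↦ t + (T / (n + 1)).toNNReal) ?_ hle fun n ↦ ?_
    · simpa using tendsto_const_nhds.add hmesh
    · simp only [gridTime_succ hT]
      gcongr
      exact (hlt n).le
  have ha : Tendsto (fun n ↦ gridTime T n (k n)) atTop (𝓝 t) := by
    refine tendsto_of_tendsto_of_tendsto_of_le_of_le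
      (g := fun n : ℕ ↦ t - (T / (n + 1)).toNNReal) ?_ tendsto_const_nhds (fun n ↦ ?_)
      fun n ↦ (hlt n).le
    · simpa using tendsto_const_nhds.sub hmesh
    · rw [tsub_le_iff_right, ← gridTime_succ hT]
      exact hle n
  have h1 := (hr.tendsto.comp (tendsto_nhdsWithin_iff.2 ⟨hb, .of_forall hle⟩)).sub
    (hl.comp (tendsto_nhdsWithin_iff.2 ⟨ha, .of_forall hlt⟩))
  filter_upwards [h1.abs.eventually_const_lt hε] with n hn
  exact ⟨k n, hk n, hn.le⟩

variable {Ω : Type*} [MeasurableSpace Ω] {P : Measure Ω}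
  {X : ℝ≥0 → Ω → ℝ}

/-- Union bound over the `n + 1` cells, with `v + 1` in place of `v` to cover `v = 0`. -/
lemma measureReal_large_increment_le {v : ℝ≥0} (hT : 0 < T)
    (hlaw : ∀ s t, HasLaw (fun ω ↦ X (s + t) ω - X s ω) (gaussianReal 0 (v * t)) P) {ε : ℝ}
    (hε : 0 ≤ ε) (n : ℕ) :
    P.real {ω | ∃ k < n + 1, ε ≤ |X (gridTime T n (k + 1)) ω - X (gridTime T n k) ω|} ≤
      2 * ((n + 1) * Real.exp (-(ε ^ 2 / (2 * ((v + 1) * T))) * (n + 1))) := by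
  have h1 : {ω | ∃ k < n + 1, ε ≤ |X (gridTime T n (k + 1)) ω - X (gridTime T n k) ω|} =
      ⋃ k ∈ Finset.range (n + 1),
        {ω | ε ≤ |X (gridTime T n (k + 1)) ω - X (gridTime T n k) ω|} := by
    ext ω
    simp
  rw [h1]
  refine (measureReal_biUnion_finset_le _ _).trans ?_
  have h2 (k : ℕ) : P.real {ω | ε ≤ |X (gridTime T n (k + 1)) ω - X (gridTime T n k) ω|} ≤
      2 * Real.exp (-(ε ^ 2 / (2 * ((v + 1) * T))) * (n + 1)) := by
    have h3 := (hlaw (gridTime T n k) (T / (n + 1)).toNNReal).measure_eq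
      (p := fun x ↦ ε ≤ |x|) (measurableSet_le measurable_const measurable_abs)
    rw [← gridTime_succ hT] at h3
    have h4 := gaussianReal_abs_ge_le (w := v * (T / (n + 1)).toNNReal)
      (w' := (v + 1) * (T / (n + 1)).toNNReal) (by gcongr; simp) hε
    have h5 : -ε ^ 2 / (2 * ((v + 1) * (T / (n + 1)).toNNReal : ℝ≥0)) =
        -(ε ^ 2 / (2 * ((v + 1) * T))) * (n + 1) := by
      rw [NNReal.coe_mul, Real.coe_toNNReal _ (mesh_pos hT n).le]
      push_cast
      field_simp
    rw [h5] at h4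
    rw [measureReal_def, h3]
    exact h4
  refine (Finset.sum_le_sum fun k _ ↦ h2 k).trans (le_of_eq ?_)
  simp
  ring

lemma tendsto_measure_large_increment [IsProbabilityMeasure P] {v : ℝ≥0} (hT : 0 < T)
    (hlaw : ∀ s t, HasLaw (fun ω ↦ X (s + t) ω - X s ω) (gaussianReal 0 (v * t)) P) {ε : ℝ}
    (hε : 0 < ε) :
    Tendsto (fun n ↦ P {ω | ∃ k < n + 1,
      ε ≤ |X (gridTime T n (k + 1)) ω - X (gridTime T n k) ω|}) atTop (𝓝 0) := by
  rw [← ENNReal.tendsto_toReal_iff (fun n ↦ measure_ne_top _ _) ENNReal.zero_ne_top]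
  have hb : 0 < ε ^ 2 / (2 * ((v + 1) * T)) := by positivity
  have h1 := (tendsto_rpow_mul_exp_neg_mul_atTop_nhds_zero 1 _ hb).comp
    (tendsto_atTop_add_const_right _ (1 : ℝ) tendsto_natCast_atTop_atTop)
  have h2 := h1.const_mul 2
  simp only [Function.comp_def, Real.rpow_one, mul_zero] at h2
  exact squeeze_zero (fun n ↦ ENNReal.toReal_nonneg)
    (fun n ↦ measureReal_large_increment_le hT hlaw hε.le n) h2

/-- A càdlàg process with centered Gaussian increments of variance `v (t - s)` is continuous. -/
lemma ae_continuous_of_gaussian_increments [IsProbabilityMeasure P] {v : ℝ≥0}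
    (hc : ∀ᵐ ω ∂P, IsCadlag fun t ↦ X t ω)
    (hlaw : ∀ s t, HasLaw (fun ω ↦ X (s + t) ω - X s ω) (gaussianReal 0 (v * t)) P) :
    ∀ᵐ ω ∂P, Continuous fun t ↦ X t ω := by
  -- Countably many horizons and jump sizes. A jump would put `ω` in these sets for all large `n`.
  have hB : ∀ᵐ ω ∂P, ∀ N m : ℕ, ∃ᶠ n in atTop, ω ∉ {ω | ∃ k < n + 1, 1 / (m + 1 : ℝ) ≤
      |X (gridTime (N + 1) n (k + 1)) ω - X (gridTime (N + 1) n k) ω|} :=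
    ae_all_iff.2 fun N ↦ ae_all_iff.2 fun m ↦
      ae_frequently_notMem (tendsto_measure_large_increment (by positivity) hlaw (by positivity))
  filter_upwards [hc, hB] with ω hω hBω
  refine continuous_iff_continuousAt.2 fun t ↦ ?_
  obtain ⟨hr, l, hl⟩ := hω t
  refine continuousAt_iff_continuous_left'_right'.2 ⟨?_, hr.mono Set.Ioi_subset_Ici_self⟩
  rcases eq_zero_or_pos t with rfl | ht
  · simp [ContinuousWithinAt]
  · suffices X t ω = l by
      rw [ContinuousWithinAt, this]
      exact hl
    by_contra hne
    obtain ⟨m, hm⟩ := exists_nat_one_div_lt (abs_pos.2 (sub_ne_zero.2 hne))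
    obtain ⟨N, hN⟩ := exists_nat_ge (t : ℝ)
    have := eventually_exists_large_increment (T := N + 1) (by positivity) ht (by linarith) hr hl hm
    exact hBω N m (this.mono fun n hn ↦ not_not.2 hn)

end Continuity

/-! ### No jumps versus scaled Wiener process -/

section Wiener

variable {Ω : Type*} [MeasurableSpace Ω] {P : Measure Ω}
  {X : ℝ≥0 → Ω → ℝ} {h : ℝ → ℝ} {a : ℝ} {v : ℝ≥0} {ν : Measure ℝ}

lemma levyExponent_zero_measure (z : ℝ) :
    levyExponent h a v 0 z = ((v * z ^ 2 / 2 : ℝ) : ℂ) - Complex.I * (a * z : ℝ) := by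
  simp [levyExponent]
  ring

lemma isScaledWiener_of_levyMeasure_eq_zero [IsProbabilityMeasure P]
    (hX : IsCenteredSquareIntegrableLevy X P)
    (hν : HasGeneratingTriple X P h a v 0) : IsScaledWiener X P := by
  have hlaw₀ (s t : ℝ≥0) :
      HasLaw (fun ω ↦ X (s + t) ω - X s ω) (gaussianReal (a * t) (v * t)) P := by
    have hm : Measurable fun ω ↦ X (s + t) ω - X s ω := (hX.measurable _).sub (hX.measurable _)
    refine ⟨hm.aemeasurable, ?_⟩
    have := Measure.isProbabilityMeasure_map (μ := P) hm.aemeasurable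
    refine Measure.ext_of_charFun (funext fun z ↦ ?_)
    rw [charFun_apply_real, charFun_gaussianReal, integral_map hm.aemeasurable (by fun_prop)]
    have h1 := integral_exp_increment hX.toIsLevyProcess hν s t z
    rw [levyExponent_zero_measure] at h1
    convert! h1 using 2
    · funext ω
      ring_nf
    · push_cast
      ring
  -- The drift is the mean, which is zero.
  have ha (t : ℝ≥0) : a * t = 0 := by
    have h1 := (hlaw₀ 0 t).integral_eq
    rw [integral_id_gaussianReal] at h1
    rw [← h1, ← hX.mean t]
    refine integral_congr_ae ?_
    filter_upwards [hX.zero] with ω h0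
    simp [h0]
  have hlaw (s t : ℝ≥0) : HasLaw (fun ω ↦ X (s + t) ω - X s ω) (gaussianReal 0 (v * t)) P :=
    ha t ▸ hlaw₀ s t
  refine ⟨v, hX.zero, hX.indep, fun s t hst ↦ ?_,
    ae_continuous_of_gaussian_increments hX.cadlag hlaw⟩
  have := hlaw s (t - s)
  rwa [add_tsub_cancel_of_le hst] at this

lemma levyMeasure_eq_zero_of_isScaledWiener (hν : HasGeneratingTriple X P h a v ν)
    (hW : IsScaledWiener X P) : ν = 0 := by
  obtain ⟨w, h0, -, hlaw, -⟩ := hW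
  -- Moduli at time `1` give a quadratic real part, enough to exclude jumps without uniqueness of
  -- the triple.
  have key (z : ℝ) : (levyExponent h a v ν z).re = w * z ^ 2 / 2 := by
    have h1 := hlaw 0 1 zero_le_one
    have h2 : charFun (gaussianReal 0 (w * (1 - 0))) z =
        Complex.exp (-levyExponent h a v ν z) := by
      have h3 := hν.charFun_eq 1 z
      rw [NNReal.coe_one, Complex.ofReal_one, neg_one_mul] at h3
      rw [← h3, ← h1.map_eq, charFun_apply_real, integral_map h1.aemeasurable (by fun_prop)]
      refine integral_congr_ae ?_
      filter_upwards [h0] with ω hω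
      rw [hω, sub_zero]
      ring_nf
    rw [charFun_gaussianReal] at h2
    have h4 := congrArg norm h2
    rw [Complex.norm_exp, Complex.norm_exp, Real.exp_eq_exp] at h4
    have h5 : (z : ℂ) * (0 : ℝ) * Complex.I - ((w * (1 - 0) : ℝ≥0) : ℂ) * z ^ 2 / 2 =
        ((-(w * z ^ 2 / 2) : ℝ) : ℂ) := by
      push_cast [tsub_zero]
      ring
    rw [h5, Complex.ofReal_re, Complex.neg_re] at h4
    linarith
  refine hν.isLevyMeasure.eq_zero_of_re_levyExponent (h := h) (a := a) (v := v) hν.integrable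
    fun z ↦ ?_
  rw [key, key]
  ring

end Wiener

/-! ### Independence through the exponent -/

section Independence

variable {Ω : Type*} [MeasurableSpace Ω] {P : Measure Ω} [IsProbabilityMeasure P]
  {X : ℝ≥0 → Ω → ℝ} {h : ℝ → ℝ} {a : ℝ} {v : ℝ≥0} {ν : Measure ℝ} {T : ℝ}

lemma integral_exp_sum_stochCoeff (hX : IsLevyProcess X P) (hν : HasGeneratingTriple X P h a v ν)
    (hT : 0 < T) {ι : Type*} [Fintype ι] {f : ι → ℝ → ℝ}
    (hf : ∀ i, IntegrableOn (f i) (Set.Icc 0 T)) (z : ι → ℝ) :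
    ∫ ω, Complex.exp (Complex.I * (∑ i, z i * stochCoeff X T (f i) ω : ℝ)) ∂P =
      Complex.exp (-∫ t in Set.Icc 0 T,
        levyExponent h a v ν (∑ i, z i * tailIntegral T (f i) t)) := by
  have h1 : IntegrableOn (fun t ↦ ∑ i, z i * f i t) (Set.Icc 0 T) :=
    integrable_finsetSum _ fun i _ ↦ (hf i).const_mul (z i)
  have h2 := integral_exp_stochCoeff hX hν hT h1
  simp only [tailIntegral_sum Finset.univ z f hf] at h2
  rw [← h2]
  refine integral_congr_ae ?_
  filter_upwards [hX.stochCoeff_sum hT Finset.univ z f hf] with ω hω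
  rw [hω]

lemma integral_exp_mul_stochCoeff (hX : IsLevyProcess X P) (hν : HasGeneratingTriple X P h a v ν)
    (hT : 0 < T) {f : ℝ → ℝ} (hf : IntegrableOn f (Set.Icc 0 T)) (z : ℝ) :
    ∫ ω, Complex.exp (Complex.I * (z * stochCoeff X T f ω : ℝ)) ∂P =
      Complex.exp (-∫ t in Set.Icc 0 T, levyExponent h a v ν (z * tailIntegral T f t)) := by
  have := integral_exp_sum_stochCoeff hX hν hT (fun _ : Unit ↦ hf) fun _ ↦ z
  simpa using this

/-- Independence of stochastic coefficients in terms of the characteristic exponent. -/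
lemma iIndepFun_stochCoeff_iff (hX : IsLevyProcess X P) (hν : HasGeneratingTriple X P h a v ν)
    (hT : 0 < T) {ι : Type*} [Fintype ι] {f : ι → ℝ → ℝ}
    (hf : ∀ i, IntegrableOn (f i) (Set.Icc 0 T)) :
    iIndepFun (fun i ↦ stochCoeff X T (f i)) P ↔ ∀ z : ι → ℝ,
      Complex.exp (-∫ t in Set.Icc 0 T,
        levyExponent h a v ν (∑ i, z i * tailIntegral T (f i) t)) =
      ∏ i, Complex.exp (-∫ t in Set.Icc 0 T,
        levyExponent h a v ν (z i * tailIntegral T (f i) t)) := by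
  have hm (i : ι) := hX.aemeasurable_stochCoeff hT (hf i)
  have h1 (z : EuclideanSpace ℝ ι) :
      charFun (P.map fun ω ↦ WithLp.toLp 2 fun i ↦ stochCoeff X T (f i) ω) z =
        Complex.exp (-∫ t in Set.Icc 0 T,
          levyExponent h a v ν (∑ i, z i * tailIntegral T (f i) t)) := by
    rw [charFun_apply, integral_map (by fun_prop) (by fun_prop),
      ← integral_exp_sum_stochCoeff hX hν hT hf]
    simp [PiLp.inner_apply, mul_comm]
  have h2 (i : ι) (z : ℝ) : charFun (P.map (stochCoeff X T (f i))) z =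
      Complex.exp (-∫ t in Set.Icc 0 T, levyExponent h a v ν (z * tailIntegral T (f i) t)) := by
    rw [charFun_apply_real, integral_map (hm i) (by fun_prop),
      ← integral_exp_mul_stochCoeff hX hν hT (hf i)]
    simp [mul_comm]
  rw [iIndepFun_iff_charFun_pi hm]
  simp only [h1, h2]
  exact ⟨fun H z ↦ H (WithLp.toLp 2 z), fun H z ↦ H z⟩

/-- Passing to moduli avoids the `2πi` ambiguity of the complex logarithm. -/
lemma integral_re_levyExponent_sum (hX : IsLevyProcess X P)
    (hν : HasGeneratingTriple X P h a v ν) (hT : 0 < T) {ι : Type*} [Fintype ι] {f : ι → ℝ → ℝ}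
    (hf : ∀ i, IntegrableOn (f i) (Set.Icc 0 T))
    (hind : iIndepFun (fun i ↦ stochCoeff X T (f i)) P) (z : ι → ℝ) :
    ∫ t in Set.Icc 0 T, (levyExponent h a v ν (∑ i, z i * tailIntegral T (f i) t)).re =
      ∑ i, ∫ t in Set.Icc 0 T, (levyExponent h a v ν (z i * tailIntegral T (f i) t)).re := by
  have hΨ : Continuous (levyExponent h a v ν) :=
    continuous_levyExponent hν.isLevyMeasure hν.integrable
  have hu (i : ι) := continuous_tailIntegral (hf i)
  have hn {w : ℝ → ℝ} (hw : Continuous w) :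
      ‖Complex.exp (-∫ t in Set.Icc 0 T, levyExponent h a v ν (w t))‖ =
        Real.exp (-∫ t in Set.Icc 0 T, (levyExponent h a v ν (w t)).re) := by
    have h1 : IntegrableOn (fun t ↦ levyExponent h a v ν (w t)) (Set.Icc 0 T) :=
      (hΨ.comp hw).continuousOn.integrableOn_compact isCompact_Icc
    have h2 := integral_re (𝕜 := ℂ) h1
    simp only [RCLike.re_to_complex] at h2
    rw [Complex.norm_exp, Complex.neg_re, h2]
  have h1 := congrArg norm ((iIndepFun_stochCoeff_iff hX hν hT hf).1 hind z)
  rw [norm_prod, hn (by fun_prop)] at h1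
  simp only [fun i ↦ hn ((hu i).const_mul (z i)), ← Real.exp_sum] at h1
  rw [Real.exp_eq_exp, Finset.sum_neg_distrib] at h1
  exact neg_injective h1

/-- If two coefficients are independent and their kernels do not vanish at `0`, there are no
jumps. -/
lemma levyMeasure_eq_zero_of_indep (hX : IsLevyProcess X P)
    (hν : HasGeneratingTriple X P h a v ν) (hT : 0 < T) {f : Fin 2 → ℝ → ℝ}
    (hf : ∀ i, IntegrableOn (f i) (Set.Icc 0 T)) (h0 : ∀ i, tailIntegral T (f i) 0 ≠ 0)
    (hind : iIndepFun (fun i ↦ stochCoeff X T (f i)) P) : ν = 0 := by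
  set R : ℝ → ℝ := fun z ↦ (levyExponent h a v ν z).re
  have hR : Continuous R :=
    Complex.continuous_re.comp (continuous_levyExponent hν.isLevyMeasure hν.integrable)
  set u := fun i ↦ tailIntegral T (f i)
  have hu (i) : Continuous (u i) := continuous_tailIntegral (hf i)
  have key (p q : ℝ) : 2 * R (p * u 0 0) + 2 * R (q * u 1 0) - R (p * u 0 0 + q * u 1 0) -
      R (p * u 0 0 - q * u 1 0) = 0 := by
    set G : ℝ → ℝ := fun t ↦ 2 * R (p * u 0 t) + 2 * R (q * u 1 t) - R (p * u 0 t + q * u 1 t) -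
      R (p * u 0 t - q * u 1 t)
    have hG : Continuous G := by fun_prop
    have hi {F : ℝ → ℝ} (hF : Continuous F) : IntegrableOn F (Set.Icc 0 T) :=
      hF.continuousOn.integrableOn_compact isCompact_Icc
    have h1 := integral_re_levyExponent_sum hX hν hT hf hind ![p, q]
    have h2 := integral_re_levyExponent_sum hX hν hT hf hind ![p, -q]
    simp only [Fin.sum_univ_two, Matrix.cons_val_zero, Matrix.cons_val_one, neg_mul,
      ← sub_eq_add_neg, re_levyExponent_neg hν.integrable] at h1 h2
    have h3 : ∫ t in Set.Icc 0 T, G t = 0 := by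
      have e : ∀ t, G t = (2 * R (p * u 0 t) + 2 * R (q * u 1 t)) -
        (R (p * u 0 t + q * u 1 t) + R (p * u 0 t - q * u 1 t)) := fun t ↦ by
          simp only [G]; ring
      simp only [e]
      rw [integral_sub (hi (by fun_prop)) (hi (by fun_prop)),
        integral_add (hi (by fun_prop)) (hi (by fun_prop)),
        integral_add (hi (by fun_prop)) (hi (by fun_prop)), integral_const_mul,
        integral_const_mul, h1, h2]
      ring
    rw [integral_eq_zero_iff_of_nonneg
      (fun t ↦ re_levyExponent_parallelogram_nonneg hν.integrable _ _) (hi hG)] at h3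
    -- A continuous function that is zero a.e. on `[0,T]` is zero at the endpoint `0`.
    exact Measure.eqOn_Icc_of_ae_eq volume hT.ne h3 hG.continuousOn continuousOn_const
      (Set.left_mem_Icc.2 hT.le)
  refine hν.isLevyMeasure.eq_zero_of_re_levyExponent (h := h) (a := a) (v := v) hν.integrable
    fun z ↦ ?_
  have h1 := key (z / u 0 0) (z / u 1 0)
  rw [div_mul_cancel₀ z (h0 0), div_mul_cancel₀ z (h0 1), sub_self] at h1
  have h2 : R 0 = 0 := by simp [R, re_levyExponent hν.integrable]
  change R (z + z) = 4 * R z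
  linarith

lemma re_levyExponent_eq_zero_of_variance (hX : IsCenteredSquareIntegrableLevy X P)
    (hν : HasGeneratingTriple X P h a v ν) (hc : Var[X 1; P] = 0) (z : ℝ) :
    (levyExponent h a v ν z).re = 0 := by
  have h0 := ae_eq_integral_of_variance_eq_zero (hX.memLp 1) hc
  have h1 : ∫ ω, Complex.exp (Complex.I * z * X 1 ω) ∂P = 1 := by
    rw [integral_congr_ae (g := fun _ ↦ (1 : ℂ))]
    · simp
    · filter_upwards [h0] with ω hω
      simp [hω, hX.mean 1]
  have h2 := congrArg norm ((hν.charFun_eq 1 z).symm.trans h1)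
  rw [Complex.norm_exp] at h2
  simpa using h2

/-- Without jumps only the cross terms of a quadratic form obstruct factorization. Keeping `v` in
`horth` includes the case `v = 0`. -/
lemma iIndepFun_stochCoeff_of_orthogonal (hX : IsLevyProcess X P)
    (hν : HasGeneratingTriple X P h a v 0) (hT : 0 < T) {ι : Type*} [Fintype ι] {f : ι → ℝ → ℝ}
    (hf : ∀ i, IntegrableOn (f i) (Set.Icc 0 T))
    (horth : ∀ i j, i ≠ j →
      v * ∫ t in Set.Icc 0 T, tailIntegral T (f i) t * tailIntegral T (f j) t = 0) :
    iIndepFun (fun i ↦ stochCoeff X T (f i)) P := by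
  classical
  rw [iIndepFun_stochCoeff_iff hX hν hT hf]
  intro z
  have hi {F : ℝ → ℝ} (hF : Continuous F) : IntegrableOn F (Set.Icc 0 T) :=
    hF.continuousOn.integrableOn_compact isCompact_Icc
  have hu (i : ι) := continuous_tailIntegral (hf i)
  have hΨ {w : ℝ → ℝ} (hw : Continuous w) : ∫ t in Set.Icc 0 T, levyExponent h a v 0 (w t) =
      ((2⁻¹ * (v * ∫ t in Set.Icc 0 T, w t * w t) : ℝ) : ℂ) -
        Complex.I * (a * ∫ t in Set.Icc 0 T, w t : ℝ) := by
    have e (t : ℝ) : levyExponent h a v 0 (w t) =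
        ((2⁻¹ * (v * (w t * w t)) : ℝ) : ℂ) - Complex.I * (a * w t : ℝ) := by
      rw [levyExponent_zero_measure]
      push_cast
      ring
    simp only [e]
    rw [integral_sub, integral_const_mul, integral_complex_ofReal, integral_complex_ofReal,
      integral_const_mul, integral_const_mul, integral_const_mul]
    · exact (hi (F := fun t ↦ 2⁻¹ * (v * (w t * w t))) (by fun_prop)).ofReal
    · exact (hi (F := fun t ↦ a * w t) (by fun_prop)).ofReal.const_mul _
  have h1 : ∫ t in Set.Icc 0 T, ∑ i, z i * tailIntegral T (f i) t =
      ∑ i, ∫ t in Set.Icc 0 T, z i * tailIntegral T (f i) t :=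
    integral_finsetSum _ fun i _ ↦ hi (by fun_prop)
  have h2 : v * ∫ t in Set.Icc 0 T, (∑ i, z i * tailIntegral T (f i) t) *
        (∑ i, z i * tailIntegral T (f i) t) =
      ∑ i, v * ∫ t in Set.Icc 0 T, (z i * tailIntegral T (f i) t) *
        (z i * tailIntegral T (f i) t) := by
    simp only [Finset.sum_mul_sum]
    rw [integral_finsetSum _ fun i _ ↦ hi (by fun_prop), Finset.mul_sum]
    refine Finset.sum_congr rfl fun i _ ↦ ?_
    rw [integral_finsetSum _ fun j _ ↦ hi (by fun_prop), Finset.mul_sum]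
    refine Finset.sum_eq_single_of_mem i (Finset.mem_univ i) fun j _ hj ↦ ?_
    simp only [mul_mul_mul_comm (z i)]
    rw [integral_const_mul, mul_left_comm, horth i j hj.symm, mul_zero]
  rw [← Complex.exp_sum]
  congr 1
  rw [hΨ (by fun_prop), h1, h2, Finset.sum_neg_distrib]
  congr 1
  simp only [fun i ↦ hΨ ((hu i).const_mul (z i))]
  rw [Finset.sum_sub_distrib, ← Finset.mul_sum, Finset.mul_sum, Finset.mul_sum]
  push_cast
  rw [Finset.mul_sum, Finset.mul_sum]

end Independence

end LevyKL

theorem corollary3p5 {Ω : Type*} [MeasurableSpace Ω] (P : Measure Ω) [IsProbabilityMeasure P]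
    (X : ℝ≥0 → Ω → ℝ) (hX : LevyKL.IsCenteredSquareIntegrableLevy X P)
    (h : ℝ → ℝ) (a : ℝ) (v : ℝ≥0) (ν : Measure ℝ) (hν : LevyKL.HasGeneratingTriple X P h a v ν)
    (T : ℝ) (hT : 0 < T)
    (e : HilbertBasis ℕ ℝ (LevyKL.L2 T)) (lam : ℕ → ℝ) (he : LevyKL.IsKLBasis X P T e lam)
    (d : ℕ) (hd : 2 ≤ d) :
    (iIndepFun (fun k : Fin d ↦ LevyKL.stochCoeff X T (e (k : ℕ))) P ↔ ν = 0) ∧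
      (iIndepFun (fun k : Fin d ↦ LevyKL.stochCoeff X T (e (k : ℕ))) P ↔
        LevyKL.IsScaledWiener X P) := by
  have hindep : iIndepFun (fun k : Fin d ↦ LevyKL.stochCoeff X T (e (k : ℕ))) P ↔ ν = 0 := by
    constructor
    · intro hind
      -- If the variance is zero, the eigenrelation says nothing about the tail integrals.
      by_cases hc : Var[X 1; P] = 0
      · have h0 := LevyKL.re_levyExponent_eq_zero_of_variance hX hν hc
        refine hν.isLevyMeasure.eq_zero_of_re_levyExponent (h := h) (a := a) (v := v)
          hν.integrable fun z ↦ ?_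
        rw [h0, h0, mul_zero]
      · exact LevyKL.levyMeasure_eq_zero_of_indep (f := fun i : Fin 2 ↦ e i)
          hX.toIsLevyProcess hν hT
          (fun i ↦ LevyKL.integrableOn_L2 (e i)) (fun i ↦ he.tailIntegral_zero_ne hX hc i)
          (hind.precomp (Fin.castLE_injective hd))
    · rintro rfl
      refine LevyKL.iIndepFun_stochCoeff_of_orthogonal hX.toIsLevyProcess hν hT
        (fun k ↦ LevyKL.integrableOn_L2 (e k)) fun j k hjk ↦ ?_
      have h1 := he.integral_tail_mul_tail hX j k
      rw [if_neg (Fin.val_injective.ne hjk)] at h1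
      -- The relation carries `Var[X 1; P]`, not `v`. If the variance is zero, `Re Ψ(1) = v / 2`
      -- vanishes, so `v = 0`.
      rcases mul_eq_zero.1 h1 with hc | hc
      · have h0 := LevyKL.re_levyExponent_eq_zero_of_variance hX hν hc 1
        have hv : (v : ℝ) = 0 := by
          simpa [LevyKL.re_levyExponent hν.integrable] using h0
        rw [hv, zero_mul]
      · rw [hc, mul_zero]
  refine ⟨hindep, hindep.trans ⟨?_, LevyKL.levyMeasure_eq_zero_of_isScaledWiener hν⟩⟩
  rintro rfl
  exact LevyKL.isScaledWiener_of_levyMeasure_eq_zero hX hν
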